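/- Let $f:\mathbb R\to\mathbb C$ be even and Lebesgue measurable with $\int_0^\infty |f(x)|\left(1+\frac1x\right)dx<\infty$. For $x\neq 0$ put $$F(x)=\sum_{n\ge 1}\frac{f(n/x)}{|x|}-\int_0^\infty f(u)\,du,\qquad K(x)=\sum_{n\ge1}\frac{f(x/n)}{n}-\int_0^\infty\frac{f(1/u)}{u}\,du,$$ and $F(0)=-\int_0^\infty f(u)\,du$, $K(0)=-\int_0^\infty \frac{f(1/u)}u\,du$. We write $\int_0^{\to\infty}$ for $\lim_{b\to\infty}\int_0^b$, and $\frac{\sin(2\pi\Lambda t)}{\pi t}$ is read as $2\Lambda$ at $t=0$. The series in $F$ and $K$ converge absolutely for almost every $x$, and: 1. $F$ and $K$ are locally integrable, $\int_{\mathbb R} gF$ and $\int_{\mathbb R} gK$ converge absolutely for every Schwartz function $g$ and define tempered distributions, and these are Fourier transforms of each other (with either sign in the kernel $e^{\pm 2\pi i xy}$). 2. $\displaystyle\int_0^{\to\infty}F(x)\,dx=\tfrac12K(0)$. 3. For all $\Lambda\ge0$ and $\xi\ge0$, $$\int_0^\Lambda 2\cos(2\pi\xi x)F(x)\,dx=\int_0^{\to\infty}\left(\frac{\sin(2\pi\Lambda(t-\xi))}{\pi(t-\xi)}+\frac{\sin(2\pi\Lambda(t+\xi))}{\pi(t+\xi)}\right)K(t)\,dt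 .$$ 4. For all $\xi\ge0$ and $X>\xi$, the co-sum $\sum_{n\ge1}f(t/n)/n$ is integrable on $(0,X]$, the function $f(u)/u$ is integrable on $(0,\infty)$, and as $\Lambda\to\infty$ $$\int_0^\Lambda 2\cos(2\pi\xi x)F(x)\,dx=\int_0^X\frac{\sin(2\pi\Lambda(t-\xi))}{\pi(t-\xi)}\sum_{n\ge1}\frac{f(t/n)}{n}\,dt-\int_0^\infty\frac{f(u)}u\,du+o(1).$$ Moreover, for every real $\xi$, the improper integral $\int_0^{\to\infty}2\cos(2\pi\xi x)F(x)\,dx$ exists if and only if $\xi$ is a Dirichlet point of $K$, and its value is then the Dirichlet value of $K$ at $\xi$. Here $\xi$ is a Dirichlet point of a locally integrable function $\varphi$, with Dirichlet value $L$, if $\lim_{\Lambda\to\infty}\int_{\xi-\delta}^{\xi+\delta}\frac{\sin(2\pi\Lambda(x-\xi))}{\pi(x-\xi)}\varphi(x)\,dx=L$ for every $\delta>0$ (the choice of $\delta$ being immaterial). -/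

import Mathlib

open MeasureTheory Set Filter Topology
open scoped Real SchwartzMap FourierTransform

noncomputable section

namespace CoPoisson

/-- `F(x) = ∑_{n ≥ 1} f(n/x)/|x| - ∫_0^∞ f(u) du` for `x ≠ 0`, and `F(0) = -∫_0^∞ f(u) du`. -/
def F (f : ℝ → ℂ) (x : ℝ) : ℂ :=
  if x = 0 then -∫ u in Ioi (0 : ℝ), f u
  else (∑' n : ℕ, f (((n : ℝ) + 1) / x) / ((|x| : ℝ) : ℂ)) - ∫ u in Ioi (0 : ℝ), f u

/-- The co-sum `∑_{n ≥ 1} f(t/n)/n`. -/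
def coSum (f : ℝ → ℂ) (t : ℝ) : ℂ :=
  ∑' n : ℕ, f (t / ((n : ℝ) + 1)) / ((n : ℂ) + 1)

/-- `K(x) = ∑_{n ≥ 1} f(x/n)/n - ∫_0^∞ f(1/u)/u du` for `x ≠ 0`, and
`K(0) = -∫_0^∞ f(1/u)/u du`. -/
def K (f : ℝ → ℂ) (x : ℝ) : ℂ :=
  if x = 0 then -∫ u in Ioi (0 : ℝ), f (1 / u) / (u : ℂ)
  else coSum f x - ∫ u in Ioi (0 : ℝ), f (1 / u) / (u : ℂ)

/-- The kernel `sin(2πΛt)/(πt)`, with its continuous value `2Λ` at `t = 0`. -/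
def dirichletKernel (Λ t : ℝ) : ℝ :=
  if t = 0 then 2 * Λ else Real.sin (2 * π * Λ * t) / (π * t)

/-- The tempered distribution `T` is given by the locally integrable function `u`:
`T(g) = ∫ g u` for all Schwartz `g`, the integral being absolutely convergent. -/
def IsGivenBy (T : 𝓢'(ℝ, ℂ)) (u : ℝ → ℂ) : Prop :=
  LocallyIntegrable u volume ∧
    ∀ g : 𝓢(ℝ, ℂ), Integrable (fun x => g x * u x) volume ∧ T g = ∫ x, g x * u x

/-- `u` is integrable on each `(0, b]` and the improper integral
`lim_{b → ∞} ∫_0^b u(x) dx` exists and equals `I`. -/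
def HasImproperIntegral (u : ℝ → ℂ) (I : ℂ) : Prop :=
  (∀ b : ℝ, IntegrableOn u (Ioc 0 b) volume) ∧
    Tendsto (fun b : ℝ => ∫ x in (0 : ℝ)..b, u x) atTop (𝓝 I)

/-- `x₀` is a Dirichlet point of the locally integrable function `φ`, with Dirichlet value `L`. -/
def HasDirichletValue (φ : ℝ → ℂ) (x₀ : ℝ) (L : ℂ) : Prop :=
  LocallyIntegrable φ volume ∧ ∀ δ : ℝ, 0 < δ →
    Tendsto (fun Λ : ℝ => ∫ x in (x₀ - δ)..(x₀ + δ), (dirichletKernel Λ (x - x₀) : ℂ) * φ x)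
      atTop (𝓝 L)

end CoPoisson

end

namespace CoPoisson

/-! Everything is transferred to integrals against `f` on the half-line. By Tonelli and `t = nu`,
pairing `K` with an even-folded test function `φ` gives `∫ f(u) (∑ φ(nu) - (∫ φ)/u) du`. This is
legitimate when `φ` decays quadratically, because then `∑ |φ(nu)|` is at most a constant over `u`
and `f(u)/u` is integrable. The inversion `f ↦ f(1/x)/|x|` turns `K` into `F`, so each statement
about `K` also gives one about `F`. The Fourier duality of `F` and `K` is then Poisson summation
applied for each `u` (`integral_fourier_mul_F`).

For the improper integrals the test functions are truncated. The primitive of `F` is `-∫ {xu} f(u)/u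
du` (`primitiveF_eq`), and Fejér's lemma for the sawtooth gives its limit `K(0)/2`. The truncated
sine transform of `K` is an integral of partial Fourier sums of the same sawtooth
(`sineTransform_eq`). These sums are uniformly bounded, so dominated convergence shows that the sine
transform of `K` is the primitive of `F`. Integrating by parts against `2 cos(2πξx)` on both sides
yields the identity for every frequency `ξ`.

For the localization as `Λ → ∞`, the shifted kernels beyond `X > |ξ|` equal a bounded multiple of
the unshifted kernel plus a remainder with quadratically decaying coefficients. Riemann-Lebesgue
disposes of the remainder. The unshifted tail is the difference between the primitive of `F` and the
sine transform truncated at `X`. It vanishes because both tend to `K(0)/2`, the second since co-sums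
have one-sided Dirichlet value zero at the origin (`tendsto_kernel_mul_coSum`). What remains is a
Dirichlet integral of `K` near `ξ`. -/

theorem ae_summable_of_summable_integral_norm {α : Type*} [MeasurableSpace α] {μ : Measure α}
    {u : ℕ → α → ℂ} (hu : ∀ n, Integrable (u n) μ) (hs : Summable fun n => ∫ a, ‖u n a‖ ∂μ) :
    (∀ᵐ a ∂μ, Summable fun n => ‖u n a‖) ∧ Integrable (fun a => ∑' n, u n a) μ := by
  have hfin : ∫⁻ a, ∑' n, ‖u n a‖ₑ ∂μ ≠ ⊤ := by
    rw [lintegral_tsum fun n => (hu n).1.enorm]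
    have h (n : ℕ) : ∫⁻ a, ‖u n a‖ₑ ∂μ = ENNReal.ofReal (∫ a, ‖u n a‖ ∂μ) :=
      (ofReal_integral_norm_eq_lintegral_enorm (hu n)).symm
    simp_rw [h]
    exact hs.tsum_ofReal_ne_top
  have hae : ∀ᵐ a ∂μ, Summable fun n => ‖u n a‖ := by
    filter_upwards [ae_lt_top' (AEMeasurable.tsum fun n => (hu n).1.enorm) hfin] with a ha
    have h2 : ∑' n, (‖u n a‖₊ : ENNReal) ≠ ⊤ := ha.ne
    exact NNReal.summable_coe.2 (ENNReal.tsum_coe_ne_top_iff_summable.1 h2)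
  refine ⟨hae, ?_, ?_⟩
  · refine aestronglyMeasurable_of_tendsto_ae (f := fun N a => ∑ n ∈ Finset.range N, u n a) atTop
      (fun N => Finset.aestronglyMeasurable_fun_sum _ fun n _ => (hu n).1) ?_
    filter_upwards [hae] with a ha
    exact ha.of_norm.hasSum.tendsto_sum_nat
  · refine lt_of_le_of_lt (lintegral_mono_ae ?_) hfin.lt_top
    filter_upwards [hae] with a ha
    exact enorm_tsum_le_tsum_enorm

/-! ### Quadratic decay and sums over dilates -/

/-- The decay weight against which co-sums are integrable. -/
noncomputable def weight (t : ℝ) : ℝ := ((1 + t) ^ 2)⁻¹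

theorem weight_nonneg (t : ℝ) : 0 ≤ weight t := by unfold weight; positivity

theorem sum_weight_le {u : ℝ} (hu : 0 < u) (N : ℕ) :
    ∑ n ∈ Finset.range N, weight (((n : ℝ) + 1) * u) ≤ 1 / u := by
  -- Replacing one of the two factors `1 + (n+1)u` by `1 + nu` makes the sum telescope.
  have key : ∑ n ∈ Finset.range N, weight (((n : ℝ) + 1) * u) ≤
      (1 / u) * (1 - 1 / (1 + N * u)) := by
    induction N with
    | zero => simp
    | succ N ih =>
      rw [Finset.sum_range_succ]
      refine (add_le_add_left ih _).trans ?_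
      have h1 : (0 : ℝ) < 1 + N * u := by positivity
      have h2 : (0 : ℝ) < 1 + (N + 1) * u := by positivity
      have h3 : weight (((N : ℝ) + 1) * u) ≤ 1 / ((1 + N * u) * (1 + (N + 1) * u)) := by
        rw [weight, ← one_div]
        apply one_div_le_one_div_of_le (by positivity)
        rw [sq]
        apply mul_le_mul_of_nonneg_right _ h2.le
        linarith
      have h4 : (1 / u) * (1 - 1 / (1 + N * u)) + 1 / ((1 + N * u) * (1 + (N + 1) * u)) =
          (1 / u) * (1 - 1 / (1 + (N + 1) * u)) := by
        field_simp
        ring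
      push_cast
      linarith
  refine key.trans ?_
  have : (0 : ℝ) ≤ 1 / (1 + N * u) := by positivity
  have h5 : 0 < 1 / u := by positivity
  nlinarith

theorem summable_weight {u : ℝ} (hu : 0 < u) :
    Summable fun n : ℕ => weight (((n : ℝ) + 1) * u) :=
  summable_of_sum_range_le (fun _ => weight_nonneg _) (sum_weight_le hu)

/-- Even functions on the line, integrable on the half-line for both `du` and `du/u`. -/
structure Admissible (f : ℝ → ℂ) : Prop where
  even : ∀ x, f (-x) = f x
  int : IntegrableOn f (Ioi 0) volume
  int_div : IntegrableOn (fun u : ℝ => f u / (u : ℂ)) (Ioi 0) volume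

/-! ### Pairing co-sums with functions of quadratic decay -/

section Pairing

variable {f : ℝ → ℂ} {φ : ℝ → ℂ} {C : ℝ}

theorem dilate_integrableOn (hf : Admissible f) (hφ : Measurable φ)
    (hb : ∀ t, 0 < t → ‖φ t‖ ≤ C * weight t) (n : ℕ) :
    IntegrableOn (fun u : ℝ => f u * φ (((n : ℝ) + 1) * u)) (Ioi 0) := by
  refine Integrable.mul_bdd (c := C) hf.int
    (hφ.comp (measurable_const_mul ((n : ℝ) + 1))).aestronglyMeasurable ?_
  filter_upwards [ae_restrict_mem measurableSet_Ioi] with u hu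
  have hu' : 0 < ((n : ℝ) + 1) * u := mul_pos (by positivity) hu
  refine (hb _ hu').trans ?_
  have h0 : 0 ≤ C * weight (((n : ℝ) + 1) * u) := (norm_nonneg _).trans (hb _ hu')
  have hw : 0 < weight (((n : ℝ) + 1) * u) := by unfold weight; positivity
  have hC : 0 ≤ C := nonneg_of_mul_nonneg_left h0 hw
  have hw1 : weight (((n : ℝ) + 1) * u) ≤ 1 := by
    unfold weight
    apply inv_le_one_of_one_le₀
    nlinarith
  nlinarith

/-- By `sum_weight_le` the partial sums are dominated by `C |f(u)|/u`. This is where integrability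
of `f(u)/u` enters, and it licenses every later exchange of sum and integral. -/
theorem dilate_summable (hf : Admissible f) (hφ : Measurable φ)
    (hb : ∀ t, 0 < t → ‖φ t‖ ≤ C * weight t) :
    Summable fun n : ℕ => ∫ u in Ioi (0 : ℝ), ‖f u * φ (((n : ℝ) + 1) * u)‖ := by
  refine summable_of_sum_range_le (c := ∫ u in Ioi (0 : ℝ), C * ‖f u / (u : ℂ)‖)
    (fun n => integral_nonneg fun u => norm_nonneg _) fun N => ?_
  rw [← integral_finsetSum _ fun n _ => (dilate_integrableOn hf hφ hb n).norm]
  refine setIntegral_mono_on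
    (integrable_finsetSum _ fun n _ => (dilate_integrableOn hf hφ hb n).norm)
    (hf.int_div.norm.const_mul C) measurableSet_Ioi fun u hu => ?_
  have hu : 0 < u := hu
  have h0 : 0 ≤ C * weight u := (norm_nonneg _).trans (hb _ hu)
  have hw : 0 < weight u := by unfold weight; positivity
  have hC : 0 ≤ C := nonneg_of_mul_nonneg_left h0 hw
  calc ∑ n ∈ Finset.range N, ‖f u * φ (((n : ℝ) + 1) * u)‖
      ≤ ∑ n ∈ Finset.range N, ‖f u‖ * (C * weight (((n : ℝ) + 1) * u)) := by
        refine Finset.sum_le_sum fun n _ => ?_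
        rw [norm_mul]
        exact mul_le_mul_of_nonneg_left (hb _ (by positivity)) (norm_nonneg _)
    _ = C * (‖f u‖ * ∑ n ∈ Finset.range N, weight (((n : ℝ) + 1) * u)) := by
        rw [Finset.mul_sum, Finset.mul_sum]
        exact Finset.sum_congr rfl fun n _ => by ring
    _ ≤ C * (‖f u‖ * (1 / u)) := by gcongr; exact sum_weight_le hu N
    _ = C * ‖f u / (u : ℂ)‖ := by
        rw [norm_div, Complex.norm_real, Real.norm_of_nonneg hu.le, mul_one_div]

theorem term_eq_dilate (n : ℕ) (t : ℝ) :
    φ t * (f (t / ((n : ℝ) + 1)) / ((n : ℂ) + 1)) = (((n : ℝ) + 1)⁻¹ : ℝ) •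
      (fun u : ℝ => f u * φ (((n : ℝ) + 1) * u)) (((n : ℝ) + 1)⁻¹ * t) := by
  have h : ((n : ℝ) + 1) ≠ 0 := by positivity
  simp only [Complex.real_smul]
  rw [mul_inv_cancel_left₀ h, div_eq_inv_mul t]
  push_cast
  ring

theorem term_integrableOn (hf : Admissible f) (hφ : Measurable φ)
    (hb : ∀ t, 0 < t → ‖φ t‖ ≤ C * weight t) (n : ℕ) :
    IntegrableOn (fun t : ℝ => φ t * (f (t / ((n : ℝ) + 1)) / ((n : ℂ) + 1))) (Ioi 0) := by
  simp_rw [term_eq_dilate]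
  have h : (0 : ℝ) < ((n : ℝ) + 1)⁻¹ := by positivity
  have := (integrableOn_Ioi_comp_mul_left_iff
    (fun u : ℝ => f u * φ (((n : ℝ) + 1) * u)) 0 h).2
    (by rw [mul_zero]; exact dilate_integrableOn hf hφ hb n)
  exact Integrable.smul (((n : ℝ) + 1)⁻¹ : ℝ) this

theorem integral_term (n : ℕ) :
    ∫ t in Ioi (0 : ℝ), φ t * (f (t / ((n : ℝ) + 1)) / ((n : ℂ) + 1)) =
      ∫ u in Ioi (0 : ℝ), f u * φ (((n : ℝ) + 1) * u) := by
  have h : (0 : ℝ) < ((n : ℝ) + 1)⁻¹ := by positivity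
  simp_rw [term_eq_dilate]
  rw [integral_smul, integral_comp_mul_left_Ioi (fun u : ℝ => f u * φ (((n : ℝ) + 1) * u)) _ h, mul_zero, smul_smul, inv_inv,
    inv_mul_cancel₀ (by positivity), one_smul]

theorem integral_norm_term (n : ℕ) :
    ∫ t in Ioi (0 : ℝ), ‖φ t * (f (t / ((n : ℝ) + 1)) / ((n : ℂ) + 1))‖ =
      ∫ u in Ioi (0 : ℝ), ‖f u * φ (((n : ℝ) + 1) * u)‖ := by
  have h : (0 : ℝ) < ((n : ℝ) + 1)⁻¹ := by positivity
  simp_rw [term_eq_dilate, norm_smul, Real.norm_of_nonneg h.le]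
  rw [integral_const_mul, integral_comp_mul_left_Ioi
    (fun u : ℝ => ‖f u * φ (((n : ℝ) + 1) * u)‖) _ h, mul_zero, smul_eq_mul, inv_inv, ← mul_assoc,
    inv_mul_cancel₀ (by positivity), one_mul]

theorem mul_coSum (t : ℝ) :
    φ t * coSum f t = ∑' n : ℕ, φ t * (f (t / ((n : ℝ) + 1)) / ((n : ℂ) + 1)) := by
  rw [tsum_mul_left, coSum]

/-- Pairing a co-sum with a function of quadratic decay. -/
theorem integrableOn_mul_coSum (hf : Admissible f) (hφ : Measurable φ)
    (hb : ∀ t, 0 < t → ‖φ t‖ ≤ C * weight t) :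
    IntegrableOn (fun t => φ t * coSum f t) (Ioi 0) := by
  simp_rw [mul_coSum]
  refine (ae_summable_of_summable_integral_norm (term_integrableOn hf hφ hb) ?_).2
  simp_rw [integral_norm_term]
  exact dilate_summable hf hφ hb

theorem integral_mul_coSum (hf : Admissible f) (hφ : Measurable φ)
    (hb : ∀ t, 0 < t → ‖φ t‖ ≤ C * weight t) :
    ∫ t in Ioi (0 : ℝ), φ t * coSum f t =
      ∫ u in Ioi (0 : ℝ), f u * ∑' n : ℕ, φ (((n : ℝ) + 1) * u) := by
  simp_rw [mul_coSum, ← tsum_mul_left]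
  rw [← integral_tsum_of_summable_integral_norm (term_integrableOn hf hφ hb)
      (by simp_rw [integral_norm_term]; exact dilate_summable hf hφ hb),
    ← integral_tsum_of_summable_integral_norm (dilate_integrableOn hf hφ hb)
      (dilate_summable hf hφ hb)]
  exact tsum_congr integral_term

theorem integrableOn_mul_tsum (hf : Admissible f) (hφ : Measurable φ)
    (hb : ∀ t, 0 < t → ‖φ t‖ ≤ C * weight t) :
    IntegrableOn (fun u : ℝ => f u * ∑' n : ℕ, φ (((n : ℝ) + 1) * u)) (Ioi 0) := by
  simp_rw [← tsum_mul_left]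
  exact (ae_summable_of_summable_integral_norm (dilate_integrableOn hf hφ hb)
      (dilate_summable hf hφ hb)).2

theorem integrableOn_weight : IntegrableOn weight (Ioi 0) := by
  refine Integrable.mono' integrable_inv_one_add_sq.integrableOn
    (by unfold weight; fun_prop) ?_
  filter_upwards [ae_restrict_mem measurableSet_Ioi] with u hu
  have hu : 0 < u := hu
  rw [Real.norm_of_nonneg (weight_nonneg u), weight]
  exact inv_anti₀ (by positivity) (by nlinarith)

theorem integrableOn_of_le_weight (hφ : Measurable φ) (hb : ∀ t, 0 < t → ‖φ t‖ ≤ C * weight t) :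
    IntegrableOn φ (Ioi 0) := by
  refine Integrable.mono' (integrableOn_weight.const_mul C) hφ.aestronglyMeasurable ?_
  filter_upwards [ae_restrict_mem measurableSet_Ioi] with u hu using hb u hu

theorem ae_summable_coSum (hf : Admissible f) :
    ∀ᵐ t ∂volume.restrict (Ioi 0), Summable fun n : ℕ => ‖f (t / ((n : ℝ) + 1)) / ((n : ℂ) + 1)‖ := by
  obtain ⟨φ, hm, hb, hne⟩ : ∃ φ : ℝ → ℂ, Measurable φ ∧ (∀ t, 0 < t → ‖φ t‖ ≤ 1 * weight t) ∧
      -- A test function without zeros can be divided out of the almost everywhere summability.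
      ∀ t, 0 < t → φ t ≠ 0 := by
    refine ⟨fun t => (weight t : ℂ), by unfold weight; fun_prop, fun t _ => ?_, fun t ht => ?_⟩
    · rw [Complex.norm_real, Real.norm_of_nonneg (weight_nonneg t), one_mul]
    · have : 0 < weight t := by unfold weight; positivity
      simpa using this.ne'
  have hs : Summable fun n : ℕ => ∫ t in Ioi (0 : ℝ),
      ‖φ t * (f (t / ((n : ℝ) + 1)) / ((n : ℂ) + 1))‖ := by
    simp_rw [integral_norm_term]
    exact dilate_summable hf hm hb
  filter_upwards [(ae_summable_of_summable_integral_norm (term_integrableOn hf hm hb) hs).1,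
    ae_restrict_mem measurableSet_Ioi] with t ht ht0
  simp_rw [norm_mul] at ht
  exact (summable_mul_left_iff (norm_ne_zero_iff.2 (hne t ht0))).1 ht

end Pairing

/-! ### The inversion `x ↦ 1/x` and the exchange of `F` and `K` -/

section Inversion

variable {E : Type*} [NormedAddCommGroup E] [NormedSpace ℝ E]

theorem inv_kernel_eq (g : ℝ → E) {x : ℝ} (hx : 0 < x) :
    (|(-1 : ℝ)| * x ^ ((-1 : ℝ) - 1)) • g (x ^ (-1 : ℝ)) = (x ^ 2)⁻¹ • g x⁻¹ := by
  rw [Real.rpow_neg_one, show ((-1 : ℝ) - 1) = -(2 : ℕ) by norm_num, Real.rpow_neg hx.le,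
    Real.rpow_natCast]
  simp

theorem integral_comp_inv_Ioi (g : ℝ → E) :
    ∫ x in Ioi (0 : ℝ), (x ^ 2)⁻¹ • g x⁻¹ = ∫ x in Ioi (0 : ℝ), g x := by
  rw [← integral_comp_rpow_Ioi g (p := -1) (by norm_num)]
  exact setIntegral_congr_fun measurableSet_Ioi fun x hx => (inv_kernel_eq g hx).symm

theorem integrableOn_comp_inv_Ioi {g : ℝ → E} (hg : IntegrableOn g (Ioi 0)) :
    IntegrableOn (fun x : ℝ => (x ^ 2)⁻¹ • g x⁻¹) (Ioi 0) :=
  ((integrableOn_Ioi_comp_rpow_iff g (p := -1) (by norm_num)).2 hg).congr_fun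
    (fun _ hx => inv_kernel_eq g hx) measurableSet_Ioi

end Inversion

/-- `∫_0^∞ f(u)/u du`. -/
noncomputable def moment (f : ℝ → ℂ) : ℂ := ∫ u in Ioi (0 : ℝ), f u / (u : ℂ)

theorem integral_inv_div (f : ℝ → ℂ) :
    ∫ u in Ioi (0 : ℝ), f (1 / u) / (u : ℂ) = moment f := by
  rw [moment, ← integral_comp_inv_Ioi fun u : ℝ => f u / (u : ℂ)]
  refine setIntegral_congr_fun measurableSet_Ioi fun u hu => ?_
  have hu : (u : ℂ) ≠ 0 := by exact_mod_cast (ne_of_gt hu : u ≠ 0)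
  simp only [Complex.real_smul, one_div]
  push_cast
  field_simp

theorem K_zero (f : ℝ → ℂ) : K f 0 = -moment f := by rw [K, if_pos rfl, integral_inv_div]

theorem K_of_ne_zero (f : ℝ → ℂ) {x : ℝ} (hx : x ≠ 0) : K f x = coSum f x - moment f := by
  rw [K, if_neg hx, integral_inv_div]

theorem coSum_neg {f : ℝ → ℂ} (hf : ∀ x, f (-x) = f x) (x : ℝ) : coSum f (-x) = coSum f x := by
  simp_rw [coSum, neg_div, hf]

theorem K_neg {f : ℝ → ℂ} (hf : ∀ x, f (-x) = f x) (x : ℝ) : K f (-x) = K f x := by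
  simp_rw [K, coSum_neg hf, neg_eq_zero]

/-- The involution `f ↦ f(1/x)/|x|` exchanging sums and co-sums. -/
noncomputable def inversion (f : ℝ → ℂ) (x : ℝ) : ℂ := f x⁻¹ / ((|x| : ℝ) : ℂ)

theorem Admissible.inversion {f : ℝ → ℂ} (hf : Admissible f) : Admissible (inversion f) where
  even x := by simp [CoPoisson.inversion, hf.even, inv_neg]
  int := by
    refine (integrableOn_comp_inv_Ioi hf.int_div).congr_fun (fun x hx => ?_) measurableSet_Ioi
    have hx : 0 < x := hx
    have hx' : (x : ℂ) ≠ 0 := by exact_mod_cast hx.ne'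
    simp only [CoPoisson.inversion, Complex.real_smul, abs_of_pos hx]
    push_cast
    field_simp
  int_div := by
    refine (integrableOn_comp_inv_Ioi hf.int).congr_fun (fun x hx => ?_) measurableSet_Ioi
    have hx : 0 < x := hx
    have hx' : (x : ℂ) ≠ 0 := by exact_mod_cast hx.ne'
    simp only [CoPoisson.inversion, Complex.real_smul, abs_of_pos hx]
    push_cast
    field_simp

theorem inversion_inversion (f : ℝ → ℂ) {x : ℝ} (hx : x ≠ 0) :
    inversion (inversion f) x = f x := by
  have : ((|x| : ℝ) : ℂ) ≠ 0 := by exact_mod_cast abs_ne_zero.2 hx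
  simp only [inversion, inv_inv, abs_inv]
  push_cast
  field_simp

theorem inversion_term (f : ℝ → ℂ) {x : ℝ} (hx : x ≠ 0) (n : ℕ) :
    inversion f (x / ((n : ℝ) + 1)) / ((n : ℂ) + 1) =
      f (((n : ℝ) + 1) / x) / ((|x| : ℝ) : ℂ) := by
  have h : (0 : ℝ) < (n : ℝ) + 1 := by positivity
  have h1 : ((n : ℂ) + 1) ≠ 0 := by exact_mod_cast h.ne'
  have : ((|x| : ℝ) : ℂ) ≠ 0 := by exact_mod_cast abs_ne_zero.2 hx
  simp only [inversion, abs_div, abs_of_pos h, inv_div]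
  push_cast
  field_simp

theorem moment_inversion (f : ℝ → ℂ) : moment (inversion f) = ∫ u in Ioi (0 : ℝ), f u := by
  rw [← integral_comp_inv_Ioi f, moment]
  refine setIntegral_congr_fun measurableSet_Ioi fun u hu => ?_
  have hu' : 0 < u := hu
  have hu : (u : ℂ) ≠ 0 := by exact_mod_cast hu'.ne'
  simp only [inversion, Complex.real_smul, abs_of_pos hu']
  push_cast
  field_simp

/-- Inversion carries the terms `f(x/n)/n` to `f(n/x)/|x|` and the moment to `∫ f`, so all results
on `K` apply to `F`. -/
theorem F_eq_K_inversion (f : ℝ → ℂ) : F f = K (inversion f) := by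
  funext x
  by_cases hx : x = 0
  · rw [hx, K_zero, moment_inversion, F, if_pos rfl]
  · rw [K_of_ne_zero _ hx, moment_inversion, F, if_neg hx, coSum]
    simp_rw [inversion_term f hx]

theorem coSum_congr {f g : ℝ → ℂ} (h : ∀ x, x ≠ 0 → f x = g x) {x : ℝ} (hx : x ≠ 0) :
    coSum f x = coSum g x := by
  refine tsum_congr fun n => ?_
  rw [h _ (div_ne_zero hx (by positivity))]

theorem moment_congr {f g : ℝ → ℂ} (h : ∀ x, x ≠ 0 → f x = g x) : moment f = moment g :=
  setIntegral_congr_fun measurableSet_Ioi fun u hu => by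
    simp only [h u (ne_of_gt hu)]

/-- Inversion is an involution only away from the origin. That suffices even at `x = 0`, since the
value there is an integral over the open half-line. -/
theorem F_inversion (f : ℝ → ℂ) : F (inversion f) = K f := by
  have h : ∀ x, x ≠ 0 → inversion (inversion f) x = f x := fun x hx => inversion_inversion f hx
  rw [F_eq_K_inversion]
  funext x
  by_cases hx : x = 0
  · rw [hx, K_zero, K_zero, moment_congr h]
  · rw [K_of_ne_zero _ hx, K_of_ne_zero _ hx, moment_congr h, coSum_congr h hx]

/-! ### Pairings with `K` on the half-line and the line; `K` as a tempered distribution -/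

section HalfLine

variable {f φ : ℝ → ℂ} {C : ℝ}

theorem mul_K_eqOn (f φ : ℝ → ℂ) :
    EqOn (fun t => φ t * coSum f t - φ t * moment f) (fun t => φ t * K f t) (Ioi 0) :=
  fun t ht => by
    simp only [K_of_ne_zero f (ne_of_gt ht : t ≠ 0), mul_sub]

theorem integrableOn_mul_K (hf : Admissible f) (hφ : Measurable φ)
    (hb : ∀ t, 0 < t → ‖φ t‖ ≤ C * weight t) :
    IntegrableOn (fun t => φ t * K f t) (Ioi 0) :=
  ((integrableOn_mul_coSum hf hφ hb).sub
    ((integrableOn_of_le_weight hφ hb).mul_const _)).congr_fun (mul_K_eqOn f φ) measurableSet_Ioi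

theorem integral_mul_K (hf : Admissible f) (hφ : Measurable φ)
    (hb : ∀ t, 0 < t → ‖φ t‖ ≤ C * weight t) :
    ∫ t in Ioi (0 : ℝ), φ t * K f t = ∫ u in Ioi (0 : ℝ), f u *
      (∑' n : ℕ, φ (((n : ℝ) + 1) * u) - (∫ t in Ioi (0 : ℝ), φ t) / (u : ℂ)) := by
  rw [← setIntegral_congr_fun measurableSet_Ioi (mul_K_eqOn f φ),
    integral_sub (integrableOn_mul_coSum hf hφ hb)
      ((integrableOn_of_le_weight hφ hb).mul_const _),
    integral_mul_coSum hf hφ hb, integral_mul_const, moment, mul_comm, ← integral_mul_const,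
    ← integral_sub (integrableOn_mul_tsum hf hφ hb) (hf.int_div.mul_const _)]
  refine setIntegral_congr_fun measurableSet_Ioi fun u _ => ?_
  ring

end HalfLine

section Line

variable {f φ : ℝ → ℂ} {C : ℝ}

theorem weight_neg_bound (hb : ∀ t, ‖φ t‖ ≤ C * weight |t|) (t : ℝ) (ht : 0 < t) :
    ‖φ t + φ (-t)‖ ≤ (C + C) * weight t := by
  have h1 := hb t
  have h2 := hb (-t)
  rw [abs_neg, abs_of_pos ht] at h2
  rw [abs_of_pos ht] at h1
  linarith [norm_add_le (φ t) (φ (-t))]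

theorem integrable_of_Ioi {g : ℝ → ℂ} (h1 : IntegrableOn g (Ioi 0))
    (h2 : IntegrableOn (fun t => g (-t)) (Ioi 0)) : Integrable g := by
  have h3 : IntegrableOn g (Iic 0) := by
    have := (Measure.measurePreserving_neg (volume : Measure ℝ)).integrableOn_comp_preimage
      (Homeomorph.neg ℝ).measurableEmbedding (f := g) (s := Iio 0)
    have hpre : (Neg.neg : ℝ → ℝ) ⁻¹' Iio 0 = Ioi 0 := by ext; simp
    rw [hpre] at this
    exact (integrableOn_Iic_iff_integrableOn_Iio (by simp)).2 (this.1 h2)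
  rw [← integrableOn_univ, ← Iic_union_Ioi (a := (0 : ℝ))]
  exact h3.union h1

theorem integral_eq_Ioi {g : ℝ → ℂ} (hg : Integrable g) :
    ∫ t, g t = ∫ t in Ioi (0 : ℝ), (g t + g (-t)) := by
  rw [← intervalIntegral.integral_Iic_add_Ioi hg.integrableOn hg.integrableOn (b := 0),
    integral_add hg.integrableOn hg.comp_neg.integrableOn, integral_comp_neg_Ioi, neg_zero,
    add_comm]

theorem integrable_mul_K (hf : Admissible f) (hφ : Measurable φ)
    (hb : ∀ t, ‖φ t‖ ≤ C * weight |t|) : Integrable (fun t => φ t * K f t) := by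
  refine integrable_of_Ioi (integrableOn_mul_K hf hφ (C := C) fun t ht => ?_) ?_
  · simpa [abs_of_pos ht] using hb t
  · simp_rw [K_neg hf.even]
    refine integrableOn_mul_K hf (hφ.comp measurable_neg) (C := C) fun t ht => ?_
    simpa [abs_of_pos ht] using hb (-t)

theorem integral_line_mul_K (hf : Admissible f) (hφ : Measurable φ)
    (hb : ∀ t, ‖φ t‖ ≤ C * weight |t|) :
    ∫ t, φ t * K f t = ∫ u in Ioi (0 : ℝ), f u *
      (∑' n : ℕ, (φ (((n : ℝ) + 1) * u) + φ (-(((n : ℝ) + 1) * u))) - (∫ t, φ t) / (u : ℂ)) := by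
  have hint : Integrable φ := by
    refine integrable_of_Ioi (integrableOn_of_le_weight hφ (C := C) fun t ht => ?_)
      (integrableOn_of_le_weight (hφ.comp measurable_neg) (C := C) fun t ht => ?_)
    · simpa [abs_of_pos ht] using hb t
    · simpa [abs_of_pos ht] using hb (-t)
  rw [integral_eq_Ioi (integrable_mul_K hf hφ hb), integral_eq_Ioi hint]
  simp_rw [K_neg hf.even, ← add_mul]
  exact integral_mul_K hf (φ := fun t => φ t + φ (-t)) (hφ.add (hφ.comp measurable_neg))
    (weight_neg_bound hb)

theorem locallyIntegrable_K (hf : Admissible f) : LocallyIntegrable (K f) := by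
  have h : Integrable (fun t : ℝ => ((weight |t| : ℝ) : ℂ) * K f t) :=
    integrable_mul_K hf (C := 1) (by unfold weight; fun_prop) fun t => by
      rw [Complex.norm_real, Real.norm_of_nonneg (weight_nonneg _), one_mul]
  -- The product of `K` with the weight is integrable; multiplying by the continuous reciprocal of
  -- the weight recovers `K`.
  have hc : Continuous fun t : ℝ => (((1 + |t|) ^ 2 : ℝ) : ℂ) := by fun_prop
  have h2 := h.locallyIntegrable.continuous_mul hc
  refine h2.congr (Eventually.of_forall fun t => ?_)
  have : (((1 + |t|) ^ 2 : ℝ) : ℂ) ≠ 0 := by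
    have : (0 : ℝ) < (1 + |t|) ^ 2 := by positivity
    exact_mod_cast this.ne'
  simp only [weight, Complex.ofReal_inv]
  rw [mul_inv_cancel_left₀ this]

theorem schwartz_le_weight (g : 𝓢(ℝ, ℂ)) : ∃ C : ℝ, ∀ t, ‖g t‖ ≤ C * weight |t| := by
  refine ⟨2 ^ 2 * (Finset.Iic ((2, 0) : ℕ × ℕ)).sup
    (fun m => SchwartzMap.seminorm ℂ m.1 m.2) g, fun t => ?_⟩
  have h := SchwartzMap.one_add_le_sup_seminorm_apply (𝕜 := ℂ) (m := (2, 0)) (k := 2) (n := 0)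
    le_rfl le_rfl g t
  rw [norm_iteratedFDeriv_zero, Real.norm_eq_abs] at h
  rw [weight, ← div_eq_mul_inv, le_div_iff₀ (by positivity), mul_comm]
  exact h

/-- `K/(1 + t²)` is integrable, hence a tempered distribution, and multiplication by the polynomial
`1 + t²` preserves temperedness. The smooth `1 + t²` replaces `(1 + |t|)²`, at the cost of the
constant `2`. -/
theorem exists_isGivenBy_K (hf : Admissible f) : ∃ T : 𝓢'(ℝ, ℂ), IsGivenBy T (K f) := by
  have hgrow : Function.HasTemperateGrowth (fun t : ℝ => (1 + (t : ℂ) ^ 2)) :=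
    (Function.HasTemperateGrowth.const 1).add (Function.HasTemperateGrowth.pow Function.Complex.hasTemperateGrowth_ofReal 2)
  have hne (t : ℝ) : (1 + (t : ℂ) ^ 2) ≠ 0 := by
    have : (0 : ℝ) < 1 + t ^ 2 := by positivity
    exact_mod_cast this.ne'
  have hint : Integrable (fun t : ℝ => (1 + (t : ℂ) ^ 2)⁻¹ * K f t) := by
    refine integrable_mul_K hf (C := 2) (by fun_prop) fun t => ?_
    have h1 : (1 + (t : ℂ) ^ 2) = ((1 + t ^ 2 : ℝ) : ℂ) := by push_cast; rfl
    rw [h1, norm_inv, Complex.norm_real, Real.norm_of_nonneg (by positivity), weight,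
      ← div_eq_mul_inv, inv_eq_one_div, div_le_div_iff₀ (by positivity) (by positivity)]
    nlinarith [sq_nonneg (1 - |t|), sq_abs t]
  have hmem := memLp_one_iff_integrable.2 hint
  refine ⟨TemperedDistribution.smulLeftCLM ℂ (fun t : ℝ => (1 + (t : ℂ) ^ 2))
    (Lp.toTemperedDistribution (hmem.toLp _)), locallyIntegrable_K hf, fun g => ⟨?_, ?_⟩⟩
  · obtain ⟨C, hC⟩ := schwartz_le_weight g
    exact integrable_mul_K hf g.continuous.measurable hC
  · rw [TemperedDistribution.smulLeftCLM_apply_apply, Lp.toTemperedDistribution_apply]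
    refine integral_congr_ae ?_
    filter_upwards [hmem.coeFn_toLp] with t ht
    rw [ht, SchwartzMap.smulLeftCLM_apply_apply hgrow, smul_eq_mul, smul_eq_mul]
    field_simp [hne t]

end Line

/-! ### Poisson summation and the Fourier duality -/

section Poisson

theorem schwartz_summable_dilate (g : 𝓢(ℝ, ℂ)) {u : ℝ} (hu : 0 < u) :
    Summable fun n : ℤ => g (n * u) := by
  obtain ⟨C, hC⟩ := schwartz_le_weight g
  refine Summable.of_add_one_of_neg_add_one ?_ ?_
  · refine Summable.of_norm_bounded ((summable_weight hu).mul_left C) fun n => ?_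
    have := hC (((n + 1 : ℤ) : ℝ) * u)
    push_cast at this ⊢
    rwa [abs_of_nonneg (by positivity)] at this
  · refine Summable.of_norm_bounded ((summable_weight hu).mul_left C) fun n => ?_
    have := hC (((-(n + 1) : ℤ) : ℝ) * u)
    push_cast at this ⊢
    rw [show -((n : ℝ) + 1) * u = -(((n : ℝ) + 1) * u) by ring] at *
    rwa [abs_neg, abs_of_nonneg (by positivity)] at this

theorem schwartz_tsum_dilate (g : 𝓢(ℝ, ℂ)) {u : ℝ} (hu : 0 < u) :
    ∑' n : ℤ, g (n * u) =
      g 0 + ∑' n : ℕ, (g (((n : ℝ) + 1) * u) + g (-(((n : ℝ) + 1) * u))) := by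
  have h := schwartz_summable_dilate g hu
  have h1 : Summable fun n : ℕ => g (((n : ℝ) + 1) * u) := by
    refine (h.comp_injective (i := fun n : ℕ => (n : ℤ) + 1)
      fun a b hab => by simpa using hab).congr fun n => ?_
    simp
  have h2 : Summable fun n : ℕ => g (-(((n : ℝ) + 1) * u)) := by
    refine (h.comp_injective (i := fun n : ℕ => -((n : ℤ) + 1))
      fun a b hab => by simpa using hab).congr fun n => ?_
    simp only [Function.comp_apply]
    push_cast
    congr 1
    ring
  have e1 : (fun n : ℕ => g (((((n : ℤ) + 1 : ℤ)) : ℝ) * u)) = fun n : ℕ => g (((n : ℝ) + 1) * u) := by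
    funext n; push_cast; rfl
  have e2 : (fun n : ℕ => g (((-((n : ℤ) + 1) : ℤ) : ℝ) * u)) =
      fun n : ℕ => g (-(((n : ℝ) + 1) * u)) := by
    funext n; push_cast; congr 1; ring
  rw [tsum_of_add_one_of_neg_add_one (f := fun n : ℤ => g (n * u)) (by rw [e1]; exact h1)
    (by rw [e2]; exact h2), e1, e2, h1.tsum_add h2]
  simp
  ring

theorem poisson_dilate (g : 𝓢(ℝ, ℂ)) {u : ℝ} (hu : 0 < u) :
    ∑' n : ℤ, g (n * u) = (∑' n : ℤ, (𝓕 g) (n * u⁻¹)) / (u : ℂ) := by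
  let e : ℝ ≃L[ℝ] ℝ := ContinuousLinearEquiv.unitsEquivAut ℝ (Units.mk0 u hu.ne')
  let h : 𝓢(ℝ, ℂ) := SchwartzMap.compCLMOfContinuousLinearEquiv ℂ e g
  have hh : ∀ x, h x = g (x * u) := fun x => by
    simp [h, e]
  have hF : ∀ y : ℝ, (𝓕 h) y = (𝓕 g) (y * u⁻¹) / (u : ℂ) := fun y => by
    rw [SchwartzMap.fourier_coe, SchwartzMap.fourier_coe, Real.fourier_eq', Real.fourier_eq']
    simp_rw [hh]
    have := Measure.integral_comp_mul_right (fun v : ℝ => Complex.exp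
      ((↑(-2 * π * inner ℝ v (y * u⁻¹)) : ℂ) * Complex.I) • g v) u
    rw [abs_of_pos (inv_pos.2 hu), Complex.real_smul] at this
    rw [div_eq_inv_mul, ← Complex.ofReal_inv, ← this]
    congr 1
    funext v
    congr 5
    simp
    field_simp
  -- Ordinary Poisson summation for `h(x) = g(xu)`, whose transform is the dilate of that of `g` by
  -- `1/u`, divided by `u`.
  have := SchwartzMap.tsum_eq_tsum_fourier h 0
  simp only [zero_add, hh, hF] at this
  rw [this, ← tsum_div_const]
  simp

end Poisson

/-- After `u ↦ 1/u` both sides are integrals against `f`, and the integrands agree for each `u > 0`.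
In the Poisson formula for the dilate of `g` the two terms `n = 0` are `g(0) = ∫ 𝓕 g` and `𝓕 g(0) =
∫ g`; moved across, they are the terms subtracted in `F` and `K`. -/
theorem integral_fourier_mul_F {f : ℝ → ℂ} (hf : Admissible f) (g : 𝓢(ℝ, ℂ)) :
    ∫ x, (𝓕 g) x * F f x = ∫ x, g x * K f x := by
  obtain ⟨C, hC⟩ := schwartz_le_weight g
  obtain ⟨C', hC'⟩ := schwartz_le_weight (𝓕 g)
  rw [F_eq_K_inversion, integral_line_mul_K hf g.continuous.measurable hC,
    integral_line_mul_K hf.inversion (𝓕 g).continuous.measurable hC', ← integral_comp_inv_Ioi]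
  have h0 : (𝓕 g) 0 = ∫ x, g x := by
    rw [SchwartzMap.fourier_coe, Real.fourier_eq']
    simp
  have h1 : ∫ x, (𝓕 g) x = g 0 := by
    have h := congrArg (fun k : 𝓢(ℝ, ℂ) => k 0) (FourierTransform.fourierInv_fourier_eq (F := 𝓢(ℝ, ℂ)) g)
    simp only [SchwartzMap.fourierInv_coe, Real.fourierInv_eq'] at h
    simpa using h
  refine setIntegral_congr_fun measurableSet_Ioi fun u hu => ?_
  have hu : 0 < u := hu
  have hu' : (u : ℂ) ≠ 0 := by exact_mod_cast hu.ne'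
  have e1 := schwartz_tsum_dilate g hu
  have e2 := schwartz_tsum_dilate (𝓕 g) (inv_pos.2 hu)
  rw [poisson_dilate g hu, e2] at e1
  simp only [Complex.real_smul]
  rw [← sub_eq_iff_eq_add'.2 e1, h1, h0]
  simp only [inversion, inv_inv, abs_of_pos (inv_pos.2 hu)]
  push_cast
  field_simp
  ring

/-! ### The sine integral: boundedness and convergence -/

section SineIntegral

/-- The sine integral `∫_0^x sin t / t dt`. -/
noncomputable def sineIntegral (x : ℝ) : ℝ := ∫ t in (0 : ℝ)..x, Real.sinc t

theorem sinc_intervalIntegrable (a b : ℝ) : IntervalIntegrable Real.sinc volume a b :=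
  Real.continuous_sinc.intervalIntegrable a b

theorem sineIntegral_sub (a b : ℝ) :
    sineIntegral b - sineIntegral a = ∫ t in a..b, Real.sinc t :=
  intervalIntegral.integral_interval_sub_left (sinc_intervalIntegrable _ _)
    (sinc_intervalIntegrable _ _)

theorem sineIntegral_neg (x : ℝ) : sineIntegral (-x) = -sineIntegral x := by
  have h := intervalIntegral.integral_comp_neg (a := 0) (b := x) Real.sinc
  simp only [Real.sinc_neg, neg_zero] at h
  rw [sineIntegral, sineIntegral, h, intervalIntegral.integral_symm]

/-- Integration by parts: the boundary terms contribute at most `1/a + 1/b` and the remaining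
integral at most `1/a - 1/b`. -/
theorem abs_integral_sinc_le {a b : ℝ} (ha : 0 < a) (hab : a ≤ b) :
    |∫ t in a..b, Real.sinc t| ≤ 2 / a := by
  have hpos : ∀ t ∈ uIcc a b, 0 < t := fun t ht => by
    rw [uIcc_of_le hab] at ht
    exact ha.trans_le ht.1
  have hb : 0 < b := ha.trans_le hab
  have hcinv : ContinuousOn (fun t : ℝ => (t ^ 2)⁻¹) (uIcc a b) :=
    (continuousOn_pow 2).inv₀ fun t ht => (pow_pos (hpos t ht) 2).ne'
  have hparts := intervalIntegral.integral_mul_deriv_eq_deriv_mul (a := a) (b := b)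
    (u := fun t : ℝ => t⁻¹) (u' := fun t => -(t ^ 2)⁻¹) (v := fun t => -Real.cos t) (v' := Real.sin)
    (fun t ht => hasDerivAt_inv (hpos t ht).ne')
    (fun t _ => by simpa using (Real.hasDerivAt_cos t).fun_neg)
    hcinv.neg.intervalIntegrable (Real.continuous_sin.intervalIntegrable a b)
  have hinv : ∫ t in a..b, (t ^ 2)⁻¹ = a⁻¹ - b⁻¹ := by
    have := intervalIntegral.integral_eq_sub_of_hasDerivAt (a := a) (b := b)
      (f := fun t : ℝ => -t⁻¹) (f' := fun t => (t ^ 2)⁻¹)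
      (fun t ht => by simpa using (hasDerivAt_inv (hpos t ht).ne').fun_neg) hcinv.intervalIntegrable
    rw [this]; ring
  have hsinc : ∫ t in a..b, Real.sinc t = ∫ t in a..b, t⁻¹ * Real.sin t :=
    intervalIntegral.integral_congr fun t ht => by
      simp only [Real.sinc_of_ne_zero (hpos t ht).ne']
      ring
  have hrest : |∫ t in a..b, -(t ^ 2)⁻¹ * -Real.cos t| ≤ a⁻¹ - b⁻¹ := by
    rw [← hinv, ← Real.norm_eq_abs]
    refine intervalIntegral.norm_integral_le_of_norm_le hab (Eventually.of_forall fun t ht => ?_)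
      hcinv.intervalIntegrable
    rw [neg_mul_neg, norm_mul, Real.norm_of_nonneg (by positivity)]
    exact mul_le_of_le_one_right (by positivity) (Real.abs_cos_le_one t)
  rw [hsinc, hparts]
  have h1 : |b⁻¹ * -Real.cos b| ≤ b⁻¹ := by
    rw [abs_mul, abs_neg, abs_of_pos (inv_pos.2 hb)]
    exact mul_le_of_le_one_right (by positivity) (Real.abs_cos_le_one b)
  have h2 : |a⁻¹ * -Real.cos a| ≤ a⁻¹ := by
    rw [abs_mul, abs_neg, abs_of_pos (inv_pos.2 ha)]
    exact mul_le_of_le_one_right (by positivity) (Real.abs_cos_le_one a)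
  rw [abs_le] at *
  have h3 : 2 / a = a⁻¹ + a⁻¹ := by ring
  constructor <;> linarith [h1.1, h1.2, h2.1, h2.2, hrest.1, hrest.2]

theorem abs_sineIntegral_le (x : ℝ) : |sineIntegral x| ≤ 3 := by
  have hsmall : ∀ y, 0 ≤ y → y ≤ 1 → |sineIntegral y| ≤ 1 := fun y h0 h1 => by
    have := intervalIntegral.norm_integral_le_of_norm_le_const (a := 0) (b := y) (C := 1)
      (f := Real.sinc) fun t _ => Real.abs_sinc_le_one t
    rw [sub_zero, abs_of_nonneg h0, one_mul] at this
    exact this.trans h1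
  have hnn : ∀ y, 0 ≤ y → |sineIntegral y| ≤ 3 := fun y h0 => by
    rcases le_total y 1 with h1 | h1
    · linarith [hsmall y h0 h1]
    · have h2 := abs_integral_sinc_le one_pos h1
      rw [← sineIntegral_sub] at h2
      have h3 := hsmall 1 zero_le_one le_rfl
      rw [abs_le] at *
      constructor <;> linarith [h2.1, h2.2, h3.1, h3.2]
  rcases le_total 0 x with h | h
  · exact hnn x h
  · have := hnn (-x) (by linarith)
    rwa [sineIntegral_neg, abs_neg] at this

theorem exists_tendsto_sineIntegral : ∃ l, Tendsto sineIntegral atTop (𝓝 l) := by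
  refine cauchy_map_iff_exists_tendsto.1 (Metric.cauchy_iff.2 ⟨inferInstance, fun ε hε => ?_⟩)
  refine ⟨_, image_mem_map (Ici_mem_atTop (8 / ε)), ?_⟩
  have h0 : 0 < 8 / ε := by positivity
  -- The tail bound `2/a` at `a = 8/ε` is `ε/4`, so any two values differ by at most `ε/2`.
  have key : ∀ x, 8 / ε ≤ x → |sineIntegral x - sineIntegral (8 / ε)| ≤ ε / 4 := fun x hx => by
    rw [sineIntegral_sub]
    refine (abs_integral_sinc_le h0 hx).trans (le_of_eq ?_)
    field_simp
    norm_num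
  rintro _ ⟨x, hx, rfl⟩ _ ⟨y, hy, rfl⟩
  rw [Real.dist_eq]
  have hx := key x hx
  have hy := key y hy
  rw [abs_le] at hx hy
  rw [abs_lt]
  constructor <;> linarith [hx.1, hx.2, hy.1, hy.2]

end SineIntegral

/-! ### Riemann-Lebesgue for sine integrals -/

section RiemannLebesgue

theorem integral_sin_mul_eq {g : ℝ → ℂ} (hg : Integrable g) (w : ℝ) :
    ∫ t, ((Real.sin (2 * π * w * t) : ℝ) : ℂ) * g t =
      1 / (2 * Complex.I) * (𝓕 g (-w) - 𝓕 g w) := by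
  have hint (w : ℝ) : Integrable fun v : ℝ => Real.fourierChar (-(v * w)) • g v := by
    have := (Real.fourierIntegral_convergent_iff (μ := volume) (f := g) w).2 hg
    refine this.congr (Eventually.of_forall fun v => ?_)
    simp [mul_comm]
  rw [Real.fourier_real_eq, Real.fourier_real_eq, ← integral_sub (hint _) (hint _),
    ← integral_const_mul]
  refine integral_congr_ae (Eventually.of_forall fun t => ?_)
  simp only [Circle.smul_def, Real.fourierChar_apply, smul_eq_mul]
  rw [Complex.ofReal_sin, Complex.sin]
  have hI : Complex.I ≠ 0 := Complex.I_ne_zero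
  have e1 : ((2 * π * -(t * -w) : ℝ) : ℂ) * Complex.I = ((2 * π * w * t : ℝ) : ℂ) * Complex.I := by
    push_cast; ring
  have e2 : ((2 * π * -(t * w) : ℝ) : ℂ) * Complex.I = -((2 * π * w * t : ℝ) : ℂ) * Complex.I := by
    push_cast; ring
  rw [e1, e2]
  field_simp
  rw [Complex.I_sq]
  ring

theorem tendsto_integral_sin_mul {g : ℝ → ℂ} (hg : Integrable g) :
    Tendsto (fun Λ : ℝ => ∫ t, ((Real.sin (2 * π * Λ * t) : ℝ) : ℂ) * g t) atTop (𝓝 0) := by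
  have h := Real.zero_at_infty_fourier g
  rw [cocompact_eq_atBot_atTop, tendsto_sup] at h
  have h1 := ((h.1.comp tendsto_neg_atTop_atBot).sub h.2).const_mul (1 / (2 * Complex.I))
  rw [sub_zero, mul_zero] at h1
  exact h1.congr fun Λ => (integral_sin_mul_eq hg Λ).symm

theorem tendsto_integral_sin_sub_mul {g : ℝ → ℂ} (hg : Integrable g) (ξ : ℝ) :
    Tendsto (fun Λ : ℝ => ∫ t, ((Real.sin (2 * π * Λ * (t - ξ)) : ℝ) : ℂ) * g t) atTop (𝓝 0) := by
  refine (tendsto_integral_sin_mul (hg.comp_add_right ξ)).congr fun Λ => ?_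
  rw [← integral_add_right_eq_self
    (fun t => ((Real.sin (2 * π * Λ * (t - ξ)) : ℝ) : ℂ) * g t) ξ]
  simp only [add_sub_cancel_right]

theorem tendsto_setIntegral_sin_sub_mul {g : ℝ → ℂ} {s : Set ℝ} (hs : MeasurableSet s)
    (hg : IntegrableOn g s) (ξ : ℝ) :
    Tendsto (fun Λ : ℝ => ∫ t in s, ((Real.sin (2 * π * Λ * (t - ξ)) : ℝ) : ℂ) * g t)
      atTop (𝓝 0) := by
  refine (tendsto_integral_sin_sub_mul ((integrable_indicator_iff hs).2 hg) ξ).congr fun Λ => ?_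
  rw [← integral_indicator hs]
  congr 1
  funext t
  by_cases ht : t ∈ s <;> simp [ht]

end RiemannLebesgue

/-! ### The Fourier series of the sawtooth and Fejér's lemma -/

section Sawtooth

/-- The partial sums `∑_{n ≤ N} sin(2πny)/(πn)` of the Fourier series of the sawtooth. -/
noncomputable def sineSum (N : ℕ) (y : ℝ) : ℝ :=
  ∑ n ∈ Finset.range N, Real.sin (2 * π * ((n : ℝ) + 1) * y) / (π * ((n : ℝ) + 1))

theorem continuous_sineSum (N : ℕ) : Continuous (sineSum N) := by
  unfold sineSum
  exact continuous_finsetSum _ fun n _ => by fun_prop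

theorem sineSum_neg (N : ℕ) (y : ℝ) : sineSum N (-y) = -sineSum N y := by
  simp [sineSum, Real.sin_neg, neg_div]

theorem sineSum_add_int (N : ℕ) (y : ℝ) (m : ℤ) : sineSum N (y + m) = sineSum N y := by
  refine Finset.sum_congr rfl fun n _ => ?_
  rw [show 2 * π * ((n : ℝ) + 1) * (y + m) =
    2 * π * ((n : ℝ) + 1) * y + (((n + 1) * m : ℤ) : ℝ) * (2 * π) by push_cast; ring,
    Real.sin_add_int_mul_two_pi]

theorem sineSum_half (N : ℕ) : sineSum N (1 / 2) = 0 := by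
  refine Finset.sum_eq_zero fun n _ => ?_
  rw [show 2 * π * ((n : ℝ) + 1) * (1 / 2) = ((n + 1 : ℕ) : ℝ) * π by push_cast; ring,
    Real.sin_nat_mul_pi, zero_div]

theorem sin_mul_cos_sum (N : ℕ) (s : ℝ) :
    Real.sin (π * s) * (1 + ∑ n ∈ Finset.range N, 2 * Real.cos (2 * π * ((n : ℝ) + 1) * s)) =
      Real.sin (2 * π * ((N : ℝ) + 1 / 2) * s) := by
  induction N with
  | zero => simp; ring_nf
  | succ N ih =>
    rw [Finset.sum_range_succ, ← add_assoc, mul_add, ih]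
    have h1 : 2 * π * ((N : ℝ) + 1 / 2) * s = 2 * π * ((N : ℝ) + 1) * s - π * s := by ring
    have h2 : 2 * π * (((N + 1 : ℕ) : ℝ) + 1 / 2) * s = 2 * π * ((N : ℝ) + 1) * s + π * s := by
      push_cast; ring
    rw [h1, h2, Real.sin_sub, Real.sin_add]
    ring

theorem sineSum_eq_integral (N : ℕ) (y : ℝ) :
    sineSum N y = ∫ s in (0 : ℝ)..y,
      ∑ n ∈ Finset.range N, 2 * Real.cos (2 * π * ((n : ℝ) + 1) * s) := by
  have hd (s : ℝ) : HasDerivAt (sineSum N)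
      (∑ n ∈ Finset.range N, 2 * Real.cos (2 * π * ((n : ℝ) + 1) * s)) s := by
    unfold sineSum
    refine HasDerivAt.fun_sum fun n _ => ?_
    have h : (π * ((n : ℝ) + 1)) ≠ 0 := by positivity
    have := (((hasDerivAt_id s).const_mul (2 * π * ((n : ℝ) + 1))).sin).div_const (π * ((n : ℝ) + 1))
    refine this.congr_deriv ?_
    simp only [id_eq, mul_one]
    field_simp
  rw [intervalIntegral.integral_eq_sub_of_hasDerivAt (fun s _ => hd s)
    (Continuous.intervalIntegrable (continuous_finsetSum _ fun n _ => by fun_prop) _ _)]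
  simp [sineSum]

/-- The regular part of the cosecant `1 / sin(πs)` at the origin. -/
noncomputable def cscRest (s : ℝ) : ℝ := 1 / Real.sin (π * s) - 1 / (π * s)

theorem abs_cscRest_le {s : ℝ} (h0 : 0 < s) (h1 : s ≤ 1 / 2) : |cscRest s| ≤ 1 := by
  have hpi := Real.pi_pos
  have hx : 0 < π * s := by positivity
  have hx2 : π * s ≤ π / 2 := by nlinarith
  have hlow := Real.mul_le_sin hx.le hx2
  have hsin : 0 < Real.sin (π * s) := lt_of_lt_of_le (by positivity) hlow
  have hcube := Real.sin_gt_sub_cube hx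
  have hlt := Real.sin_lt hx
  rw [cscRest, abs_of_nonneg (sub_nonneg.2 (one_div_le_one_div_of_le hsin hlt.le)),
    div_sub_div _ _ hsin.ne' hx.ne', div_le_one (by positivity)]
  have h4 := Real.pi_le_four
  set x := π * s
  -- The numerator `x - sin x` is controlled by the cubic Taylor bound, the denominator `x sin x`
  -- from below by Jordan's inequality.
  have h5 : x ^ 3 / 6 ≤ 2 / π * x * x := by
    have : x ≤ 2 := by linarith
    have h6 : 1 / 2 ≤ 2 / π := by rw [div_le_div_iff₀ (by norm_num) hpi]; linarith
    nlinarith [mul_pos hx hx]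
  nlinarith

theorem integrableOn_cscRest {y : ℝ} (hy : y ≤ 1 / 2) : IntegrableOn cscRest (Ioc 0 y) := by
  refine Measure.integrableOn_of_bounded (M := 1) (by simp) ?_ ?_
  · unfold cscRest
    exact Measurable.aestronglyMeasurable (by fun_prop)
  · filter_upwards [ae_restrict_mem measurableSet_Ioc] with s hs
    exact abs_cscRest_le hs.1 (hs.2.trans hy)

/-- The derivative of the partial sum is `sin(Ms)/sin(πs) - 1` with `M = 2π(N + 1/2)`. Splitting the
cosecant into `1/(πs)` and a bounded rest gives a sine integral plus a term to which
Riemann-Lebesgue applies. -/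
theorem sineSum_eq (N : ℕ) {y : ℝ} (h0 : 0 ≤ y) (h1 : y ≤ 1 / 2) :
    sineSum N y = sineIntegral (2 * π * ((N : ℝ) + 1 / 2) * y) / π - y +
      ∫ s in Ioc 0 y, Real.sin (2 * π * ((N : ℝ) + 1 / 2) * s) * cscRest s := by
  have hpi := Real.pi_pos
  set M : ℝ := 2 * π * ((N : ℝ) + 1 / 2) with hM
  have hM0 : 0 < M := by positivity
  have hscale : ∫ s in (0 : ℝ)..y, M / π * Real.sinc (M * s) = sineIntegral (M * y) / π := by
    rw [intervalIntegral.integral_const_mul, intervalIntegral.integral_comp_mul_left _ hM0.ne',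
      mul_zero, sineIntegral, smul_eq_mul]
    field_simp
  have hi1 : IntegrableOn (fun s => M / π * Real.sinc (M * s)) (Ioc 0 y) :=
    ((Real.continuous_sinc.comp (continuous_const_mul M)).const_smul (M / π)).integrableOn_Ioc
  have hi2 : IntegrableOn (fun _ : ℝ => (1 : ℝ)) (Ioc 0 y) := continuous_const.integrableOn_Ioc
  have hi3 : IntegrableOn (fun s => Real.sin (M * s) * cscRest s) (Ioc 0 y) :=
    (integrableOn_cscRest h1).bdd_mul (c := 1) (by fun_prop)
      (Eventually.of_forall fun s => Real.abs_sin_le_one _)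
  rw [sineSum_eq_integral, ← hscale, intervalIntegral.integral_of_le h0,
    intervalIntegral.integral_of_le h0]
  have hcomb : ∫ s in Ioc 0 y, (M / π * Real.sinc (M * s) - 1 + Real.sin (M * s) * cscRest s) =
      (∫ s in Ioc 0 y, M / π * Real.sinc (M * s)) - y +
        ∫ s in Ioc 0 y, Real.sin (M * s) * cscRest s := by
    have h12 : IntegrableOn (fun s => M / π * Real.sinc (M * s) - 1) (Ioc 0 y) := hi1.sub hi2
    rw [integral_add h12 hi3, integral_sub hi1 hi2]
    simp [h0]
  rw [← hcomb]
  refine setIntegral_congr_fun measurableSet_Ioc fun s hs => ?_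
  have hs0 : 0 < s := hs.1
  have hsin : 0 < Real.sin (π * s) :=
    Real.sin_pos_of_pos_of_lt_pi (by positivity) (by nlinarith [hs.2])
  have key := sin_mul_cos_sum N s
  rw [← hM] at key
  simp only [cscRest]
  rw [Real.sinc_of_ne_zero (by positivity), ← key]
  field_simp
  ring_nf

/-- Periodicity and oddness reduce to `0 ≤ y ≤ 1/2`, where the three terms of `sineSum_eq` are
bounded separately. Uniformity in `N` and `y` is what every later dominated convergence relies on;
the constant is not sharp. -/
theorem abs_sineSum_le (N : ℕ) (y : ℝ) : |sineSum N y| ≤ 5 := by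
  have hnn : ∀ z, 0 ≤ z → z ≤ 1 / 2 → |sineSum N z| ≤ 5 := fun z h0 h1 => by
    rw [sineSum_eq N h0 h1]
    have ha : |sineIntegral (2 * π * ((N : ℝ) + 1 / 2) * z) / π| ≤ 3 := by
      rw [abs_div, abs_of_pos Real.pi_pos, div_le_iff₀ Real.pi_pos]
      nlinarith [abs_sineIntegral_le (2 * π * ((N : ℝ) + 1 / 2) * z), Real.pi_gt_three]
    have hb : |∫ s in Ioc 0 z, Real.sin (2 * π * ((N : ℝ) + 1 / 2) * s) * cscRest s| ≤ 1 := by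
      have := norm_setIntegral_le_of_norm_le_const (μ := volume) (s := Ioc 0 z) (C := 1)
        (f := fun s => Real.sin (2 * π * ((N : ℝ) + 1 / 2) * s) * cscRest s) (by simp) fun s hs => by
          rw [norm_mul]
          exact mul_le_one₀ (Real.abs_sin_le_one _) (norm_nonneg _)
            (abs_cscRest_le hs.1 (hs.2.trans h1))
      rw [Real.norm_eq_abs] at this
      refine this.trans ?_
      simp [h0]
      linarith
    rw [abs_le] at *
    constructor <;> linarith [ha.1, ha.2, hb.1, hb.2]
  have hr := abs_sub_round y
  have hy : sineSum N y = sineSum N (y - round y) := by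
    conv_lhs => rw [show y = (y - round y) + (round y : ℤ) by ring]
    rw [sineSum_add_int]
  rw [hy]
  rcases le_total 0 (y - round y) with h | h
  · exact hnn _ h ((le_abs_self _).trans hr)
  · have := hnn (-(y - round y)) (by linarith) ((neg_le_abs _).trans hr)
    rwa [sineSum_neg, abs_neg] at this

theorem tendsto_cscRest {y : ℝ} (h1 : y ≤ 1 / 2) :
    Tendsto (fun N : ℕ => ∫ s in Ioc 0 y, Real.sin (2 * π * ((N : ℝ) + 1 / 2) * s) * cscRest s)
      atTop (𝓝 0) := by
  have h := tendsto_setIntegral_sin_sub_mul measurableSet_Ioc ((integrableOn_cscRest h1).ofReal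
    (𝕜 := ℂ)) 0
  have hN : Tendsto (fun N : ℕ => (N : ℝ) + 1 / 2) atTop atTop :=
    tendsto_atTop_add_const_right _ _ tendsto_natCast_atTop_atTop
  have h2 := (Complex.continuous_re.tendsto _).comp (h.comp hN)
  refine h2.congr fun N => ?_
  simp only [Function.comp_apply, sub_zero]
  have e (s : ℝ) : ((Real.sin (2 * π * ((N : ℝ) + 1 / 2) * s) : ℝ) : ℂ) * ((cscRest s : ℝ) : ℂ) =
      ((Real.sin (2 * π * ((N : ℝ) + 1 / 2) * s) * cscRest s : ℝ) : ℂ) := by push_cast; rfl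
  exact (congrArg Complex.re (integral_congr_ae (Eventually.of_forall e))).trans
    (by rw [integral_complex_ofReal, Complex.ofReal_re])

theorem tendsto_sineArg {y : ℝ} (h0 : 0 < y) :
    Tendsto (fun N : ℕ => 2 * π * ((N : ℝ) + 1 / 2) * y) atTop atTop :=
  ((tendsto_atTop_add_const_right _ _ tendsto_natCast_atTop_atTop).const_mul_atTop
    (by positivity)).atTop_mul_const h0

/-- The limit is known to exist. It is identified at `y = 1/2`, where every partial sum of the
sawtooth vanishes, so that `l/π - 1/2 = 0`. -/
theorem tendsto_sineIntegral : Tendsto sineIntegral atTop (𝓝 (π / 2)) := by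
  obtain ⟨l, hl⟩ := exists_tendsto_sineIntegral
  have h := (((hl.comp (tendsto_sineArg (y := 1 / 2) (by norm_num))).div_const π).sub_const
    (1 / 2)).add (tendsto_cscRest (y := 1 / 2) le_rfl)
  have h2 : Tendsto (fun N : ℕ => sineSum N (1 / 2)) atTop (𝓝 (l / π - 1 / 2 + 0)) :=
    h.congr fun N => (sineSum_eq N (by norm_num) le_rfl).symm
  simp_rw [sineSum_half] at h2
  have h3 := tendsto_nhds_unique h2 tendsto_const_nhds
  have : l = π / 2 := by
    have := Real.pi_pos
    field_simp at h3
    linarith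
  rwa [← this]

theorem tendsto_sineSum_of_pos {y : ℝ} (h0 : 0 < y) (h1 : y ≤ 1 / 2) :
    Tendsto (fun N : ℕ => sineSum N y) atTop (𝓝 (1 / 2 - y)) := by
  have h := (((tendsto_sineIntegral.comp (tendsto_sineArg h0)).div_const π).sub_const y).add
    (tendsto_cscRest h1)
  have e : π / 2 / π - y + 0 = 1 / 2 - y := by
    have := Real.pi_pos.ne'
    field_simp
    ring
  rw [e] at h
  exact h.congr fun N => (sineSum_eq N h0.le h1).symm

theorem tendsto_sineSum {y : ℝ} (hy : Int.fract y ≠ 0) :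
    Tendsto (fun N : ℕ => sineSum N y) atTop (𝓝 (1 / 2 - Int.fract y)) := by
  have e (N : ℕ) : sineSum N (Int.fract y) = sineSum N y := by
    conv_rhs => rw [← Int.fract_add_floor y, sineSum_add_int]
  have hpos : 0 < Int.fract y := lt_of_le_of_ne (Int.fract_nonneg y) hy.symm
  refine Tendsto.congr e ?_
  rcases le_total (Int.fract y) (1 / 2) with h | h
  · exact tendsto_sineSum_of_pos hpos h
  · have h2 := (tendsto_sineSum_of_pos (y := 1 - Int.fract y) (by linarith [Int.fract_lt_one y])
      (by linarith)).neg
    rw [show -(1 / 2 - (1 - Int.fract y)) = 1 / 2 - Int.fract y by ring] at h2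
    refine h2.congr fun N => ?_
    rw [← sineSum_neg, show -(1 - Int.fract y) = Int.fract y + ((-1 : ℤ) : ℝ) by push_cast; ring,
      sineSum_add_int]


/-- The `n`-th harmonic samples `𝓕 g` at `±nΛ`, and its quadratic decay sums to `O(1/Λ)` by
`sum_weight_le`. Being uniform in `N`, the bound survives passage to the full sawtooth. -/
theorem norm_integral_sineSum_le (g : 𝓢(ℝ, ℂ)) : ∃ C : ℝ, ∀ (N : ℕ) (Λ : ℝ), 0 < Λ →
    ‖∫ t, ((sineSum N (Λ * t) : ℝ) : ℂ) * g t‖ ≤ C / Λ := by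
  obtain ⟨C, hC⟩ := schwartz_le_weight (𝓕 g)
  have hC0 : 0 ≤ C := by
    have := (norm_nonneg _).trans (hC 0)
    simpa [weight] using this
  refine ⟨C, fun N Λ hΛ => ?_⟩
  have hb (n : ℕ) : ‖∫ t, ((Real.sin (2 * π * (((n : ℝ) + 1) * Λ) * t) : ℝ) : ℂ) * g t‖ ≤
      C * weight (((n : ℝ) + 1) * Λ) := by
    have h0 : (0 : ℝ) ≤ ((n : ℝ) + 1) * Λ := by positivity
    rw [integral_sin_mul_eq g.integrable, norm_mul]
    have h1 := hC (((n : ℝ) + 1) * Λ)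
    have h2 := hC (-(((n : ℝ) + 1) * Λ))
    rw [SchwartzMap.fourier_coe] at h1 h2
    rw [abs_neg, abs_of_nonneg h0] at h2
    rw [abs_of_nonneg h0] at h1
    have h3 := norm_sub_le (𝓕 (g : ℝ → ℂ) (-(((n : ℝ) + 1) * Λ))) (𝓕 (g : ℝ → ℂ) (((n : ℝ) + 1) * Λ))
    have h4 : ‖(1 : ℂ) / (2 * Complex.I)‖ = 1 / 2 := by simp
    rw [h4]
    linarith
  have hi (n : ℕ) : Integrable fun t : ℝ =>
      ((1 / (π * ((n : ℝ) + 1)) : ℝ) : ℂ) *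
        (((Real.sin (2 * π * (((n : ℝ) + 1) * Λ) * t) : ℝ) : ℂ) * g t) :=
    (g.integrable.bdd_mul (c := 1) (by fun_prop) (Eventually.of_forall fun t => by
      rw [Complex.norm_real]; exact Real.abs_sin_le_one _)).const_mul _
  have e : ∫ t, ((sineSum N (Λ * t) : ℝ) : ℂ) * g t = ∑ n ∈ Finset.range N,
      ((1 / (π * ((n : ℝ) + 1)) : ℝ) : ℂ) *
        ∫ t, ((Real.sin (2 * π * (((n : ℝ) + 1) * Λ) * t) : ℝ) : ℂ) * g t := by
    simp_rw [← integral_const_mul]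
    rw [← integral_finsetSum _ fun n _ => hi n]
    congr 1
    funext t
    rw [sineSum, Complex.ofReal_sum, Finset.sum_mul]
    refine Finset.sum_congr rfl fun n _ => ?_
    rw [show 2 * π * ((n : ℝ) + 1) * (Λ * t) = 2 * π * (((n : ℝ) + 1) * Λ) * t by ring]
    push_cast
    ring
  rw [e]
  calc _ ≤ ∑ n ∈ Finset.range N, C * weight (((n : ℝ) + 1) * Λ) := by
        refine norm_sum_le_of_le _ fun n _ => ?_
        rw [norm_mul, Complex.norm_real, Real.norm_of_nonneg (by positivity)]
        refine (mul_le_of_le_one_left (norm_nonneg _) ?_).trans (hb n)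
        rw [div_le_one (by positivity)]
        nlinarith [Real.pi_gt_three, (Nat.cast_nonneg n : (0 : ℝ) ≤ n)]
    _ ≤ C * (1 / Λ) := by
        rw [← Finset.mul_sum]
        exact mul_le_mul_of_nonneg_left (sum_weight_le hΛ N) hC0
    _ = C / Λ := by ring

theorem ae_fract_mul_ne_zero {x : ℝ} (hx : x ≠ 0) : ∀ᵐ u : ℝ, Int.fract (x * u) ≠ 0 := by
  have hc : (range fun m : ℤ => (m : ℝ) / x).Countable := countable_range _
  filter_upwards [hc.ae_notMem volume] with u hu h
  refine hu ⟨⌊x * u⌋, ?_⟩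
  have h2 := Int.floor_add_fract (x * u)
  rw [h, add_zero] at h2
  simp only [h2]
  field_simp

theorem abs_sawtooth_le (y : ℝ) : |1 / 2 - Int.fract y| ≤ 1 := by
  rw [abs_le]
  constructor <;> linarith [Int.fract_nonneg y, Int.fract_lt_one y]

theorem norm_integral_sawtooth_le (g : 𝓢(ℝ, ℂ)) : ∃ C : ℝ, ∀ Λ : ℝ, 0 < Λ →
    ‖∫ t, ((1 / 2 - Int.fract (Λ * t) : ℝ) : ℂ) * g t‖ ≤ C / Λ := by
  obtain ⟨C, hC⟩ := norm_integral_sineSum_le g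
  refine ⟨C, fun Λ hΛ => ?_⟩
  have hlim : Tendsto (fun N : ℕ => ∫ t, ((sineSum N (Λ * t) : ℝ) : ℂ) * g t) atTop
      (𝓝 (∫ t, ((1 / 2 - Int.fract (Λ * t) : ℝ) : ℂ) * g t)) := by
    refine tendsto_integral_of_dominated_convergence (fun t => 5 * ‖g t‖) (fun N => ?_)
      (g.integrable.norm.const_mul 5) (fun N => Eventually.of_forall fun t => ?_) ?_
    · have := continuous_sineSum N
      exact Continuous.aestronglyMeasurable (by fun_prop)
    · rw [norm_mul, Complex.norm_real]
      exact mul_le_mul_of_nonneg_right (abs_sineSum_le _ _) (norm_nonneg _)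
    · filter_upwards [ae_fract_mul_ne_zero hΛ.ne'] with t ht
      exact ((Complex.continuous_ofReal.tendsto _).comp (tendsto_sineSum ht)).mul_const _
  exact le_of_tendsto hlim.norm (Eventually.of_forall fun N => hC N Λ hΛ)

theorem exists_schwartz_near {φ : ℝ → ℂ} (hφ : Integrable φ) {ε : ℝ} (hε : 0 < ε) :
    ∃ g : 𝓢(ℝ, ℂ), ∫ t, ‖φ t - g t‖ < ε := by
  have hd := SchwartzMap.denseRange_toLpCLM (E := ℝ) (F := ℂ) (p := 1) (μ := volume) (by simp)
  have hmem := memLp_one_iff_integrable.2 hφ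
  obtain ⟨g, hg⟩ := hd.exists_dist_lt (hmem.toLp φ) hε
  refine ⟨g, lt_of_eq_of_lt ?_ hg⟩
  rw [dist_eq_norm, L1.norm_eq_integral_norm]
  refine integral_congr_ae ?_
  filter_upwards [Lp.coeFn_sub (hmem.toLp φ) (SchwartzMap.toLpCLM ℝ ℂ 1 volume g),
    hmem.coeFn_toLp, g.coeFn_toLp 1 volume] with t h1 h2 h3
  rw [h1, Pi.sub_apply, h2, SchwartzMap.toLpCLM_apply, h3]

/-- Fejér's lemma for the sawtooth. -/
theorem tendsto_integral_sawtooth {φ : ℝ → ℂ} (hφ : Integrable φ) :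
    Tendsto (fun Λ : ℝ => ∫ t, ((1 / 2 - Int.fract (Λ * t) : ℝ) : ℂ) * φ t) atTop (𝓝 0) := by
  have hint (Λ : ℝ) {ψ : ℝ → ℂ} (hψ : Integrable ψ) :
      Integrable fun t => ((1 / 2 - Int.fract (Λ * t) : ℝ) : ℂ) * ψ t :=
    hψ.bdd_mul (c := 1) (Measurable.aestronglyMeasurable (by fun_prop))
      (Eventually.of_forall fun t => by rw [Complex.norm_real]; exact abs_sawtooth_le _)
  rw [Metric.tendsto_atTop]
  intro ε hε
  -- The sawtooth is bounded by `1`, so replacing `φ` by a Schwartz function costs at most its `L¹`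
  -- distance, uniformly in `Λ`.
  obtain ⟨g, hg⟩ := exists_schwartz_near hφ (half_pos hε)
  obtain ⟨C, hC⟩ := norm_integral_sawtooth_le g
  have hlim : Tendsto (fun Λ : ℝ => C / Λ) atTop (𝓝 0) := tendsto_const_nhds.div_atTop tendsto_id
  obtain ⟨A, hA⟩ := eventually_atTop.1 (hlim.eventually (gt_mem_nhds (half_pos hε)))
  refine ⟨max A 1, fun Λ hΛ => ?_⟩
  have hΛ0 : 0 < Λ := lt_of_lt_of_le one_pos ((le_max_right _ _).trans hΛ)
  rw [dist_zero_right]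
  have hsub : Integrable fun t => φ t - g t := hφ.sub g.integrable
  have hsplit : ∫ t, ((1 / 2 - Int.fract (Λ * t) : ℝ) : ℂ) * φ t =
      (∫ t, ((1 / 2 - Int.fract (Λ * t) : ℝ) : ℂ) * (φ t - g t)) +
        ∫ t, ((1 / 2 - Int.fract (Λ * t) : ℝ) : ℂ) * g t := by
    rw [← integral_add (hint Λ hsub) (hint Λ g.integrable)]
    congr 1
    funext t
    ring
  have h1 : ‖∫ t, ((1 / 2 - Int.fract (Λ * t) : ℝ) : ℂ) * (φ t - g t)‖ ≤ ∫ t, ‖φ t - g t‖ := by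
    refine norm_integral_le_of_norm_le hsub.norm (Eventually.of_forall fun t => ?_)
    rw [norm_mul, Complex.norm_real]
    exact mul_le_of_le_one_left (norm_nonneg _) (abs_sawtooth_le _)
  rw [hsplit]
  linarith [norm_add_le (∫ t, ((1 / 2 - Int.fract (Λ * t) : ℝ) : ℂ) * (φ t - g t))
    (∫ t, ((1 / 2 - Int.fract (Λ * t) : ℝ) : ℂ) * g t), hC Λ hΛ0, hA Λ ((le_max_left _ _).trans hΛ)]

end Sawtooth

/-! ### The Dirichlet kernel -/

section Kernel

theorem dirichletKernel_eq (Λ t : ℝ) :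
    dirichletKernel Λ t = 2 * Λ * Real.sinc (2 * π * Λ * t) := by
  by_cases ht : t = 0
  · simp [dirichletKernel, ht]
  by_cases hΛ : Λ = 0
  · simp [dirichletKernel, hΛ]
  rw [dirichletKernel, if_neg ht, Real.sinc_of_ne_zero (by positivity)]
  have := Real.pi_pos.ne'
  field_simp

theorem dirichletKernel_of_ne_zero (Λ : ℝ) {t : ℝ} (ht : t ≠ 0) :
    dirichletKernel Λ t = Real.sin (2 * π * Λ * t) / (π * t) := if_neg ht

theorem dirichletKernel_neg (Λ t : ℝ) : dirichletKernel Λ (-t) = dirichletKernel Λ t := by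
  rw [dirichletKernel_eq, dirichletKernel_eq, mul_neg, Real.sinc_neg]

theorem continuous_dirichletKernel_uncurry :
    Continuous fun p : ℝ × ℝ => dirichletKernel p.1 p.2 := by
  simp_rw [dirichletKernel_eq]
  have := Real.continuous_sinc
  fun_prop

theorem continuous_dirichletKernel (Λ : ℝ) : Continuous (dirichletKernel Λ) :=
  continuous_dirichletKernel_uncurry.comp (Continuous.prodMk_right Λ)

theorem abs_dirichletKernel_le (Λ t : ℝ) : |dirichletKernel Λ t| ≤ 2 * |Λ| := by
  rw [dirichletKernel_eq, abs_mul, abs_mul, abs_two]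
  exact mul_le_of_le_one_right (by positivity) (Real.abs_sinc_le_one _)

/-- The link between Dirichlet integrals of `K` and the sawtooth. -/
theorem sum_dirichletKernel (N : ℕ) (x : ℝ) {u : ℝ} (hu : 0 < u) :
    ∑ n ∈ Finset.range N, dirichletKernel x (((n : ℝ) + 1) * u) = sineSum N (x * u) / u := by
  rw [sineSum, Finset.sum_div]
  refine Finset.sum_congr rfl fun n _ => ?_
  rw [dirichletKernel_of_ne_zero _ (by positivity), div_div]
  ring_nf

theorem integral_dirichletKernel (x a b : ℝ) :
    ∫ t in a..b, dirichletKernel x t =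
      (sineIntegral (2 * π * x * b) - sineIntegral (2 * π * x * a)) / π := by
  simp_rw [dirichletKernel_eq]
  by_cases hx : x = 0
  · simp [hx]
  have hpi := Real.pi_pos.ne'
  rw [intervalIntegral.integral_const_mul, intervalIntegral.integral_comp_mul_left _ (by positivity),
    sineIntegral_sub, smul_eq_mul]
  field_simp

end Kernel

/-! ### Pairings over a bounded interval -/

section Truncation

variable {f ψ : ℝ → ℂ} {B T : ℝ}

theorem indicator_le_weight (hT : 0 ≤ T) (hB : ∀ t ∈ Ioc 0 T, ‖ψ t‖ ≤ B) (hB0 : 0 ≤ B)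
    (t : ℝ) (ht : 0 < t) : ‖(Ioc 0 T).indicator ψ t‖ ≤ B * (1 + T) ^ 2 * weight t := by
  by_cases h : t ∈ Ioc 0 T
  · rw [indicator_of_mem h, weight, ← div_eq_mul_inv, le_div_iff₀ (by positivity)]
    have := h.2
    gcongr
    exact hB t h
  · rw [indicator_of_notMem h, norm_zero]
    have := weight_nonneg t
    positivity

theorem tsum_indicator_dilate (ψ : ℝ → ℂ) {u : ℝ} (hu : 0 < u) (hT : 0 ≤ T) :
    ∑' n : ℕ, (Ioc 0 T).indicator ψ (((n : ℝ) + 1) * u) =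
      ∑ n ∈ Finset.range ⌊T / u⌋₊, ψ (((n : ℝ) + 1) * u) := by
  -- The positive multiples of `u` up to `T` number `⌊T/u⌋`; the index is shifted by one.
  have hmem (n : ℕ) : ((n : ℝ) + 1) * u ∈ Ioc 0 T ↔ n ∈ Finset.range ⌊T / u⌋₊ := by
    rw [Finset.mem_range, ← Nat.add_one_le_iff, Nat.le_floor_iff (by positivity), le_div_iff₀ hu]
    push_cast
    exact ⟨fun h => h.2, fun h => ⟨by positivity, h⟩⟩
  rw [tsum_eq_sum (s := Finset.range ⌊T / u⌋₊) fun n hn =>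
    indicator_of_notMem (fun h => hn ((hmem n).1 h)) _]
  exact Finset.sum_congr rfl fun n hn => indicator_of_mem ((hmem n).2 hn) _

theorem indicator_mul_eq (T : ℝ) (ψ g : ℝ → ℂ) :
    (fun t => (Ioc 0 T).indicator ψ t * g t) = (Ioc 0 T).indicator fun t => ψ t * g t := by
  funext t
  by_cases h : t ∈ Ioc 0 T <;> simp [h]

theorem setIntegral_Ioi_indicator (T : ℝ) (g : ℝ → ℂ) :
    ∫ t in Ioi (0 : ℝ), (Ioc 0 T).indicator g t = ∫ t in Ioc 0 T, g t := by
  rw [setIntegral_indicator measurableSet_Ioc, inter_eq_right.2 Ioc_subset_Ioi_self]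

theorem integrableOn_Ioc_coSum (hf : Admissible f) (T : ℝ) :
    IntegrableOn (coSum f) (Ioc 0 T) := by
  rcases lt_or_ge T 0 with hT | hT
  · simp [Ioc_eq_empty_of_le hT.le]
  have h := integrableOn_mul_coSum hf (φ := (Ioc 0 T).indicator fun _ => 1)
    (measurable_const.indicator measurableSet_Ioc)
    (indicator_le_weight (B := 1) hT (fun t _ => by simp) zero_le_one)
  rw [indicator_mul_eq] at h
  have h2 := h.mono_set (show Ioc 0 T ⊆ Ioi 0 from Ioc_subset_Ioi_self)
  refine h2.congr_fun (fun t ht => ?_) measurableSet_Ioc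
  simp [ht]

theorem integral_Ioc_mul_coSum (hf : Admissible f) (hψ : Measurable ψ) (hT : 0 ≤ T)
    (hB : ∀ t ∈ Ioc 0 T, ‖ψ t‖ ≤ B) (hB0 : 0 ≤ B) :
    ∫ t in Ioc 0 T, ψ t * coSum f t = ∫ u in Ioi (0 : ℝ), f u *
      ∑ n ∈ Finset.range ⌊T / u⌋₊, ψ (((n : ℝ) + 1) * u) := by
  rw [← setIntegral_Ioi_indicator, ← indicator_mul_eq,
    integral_mul_coSum hf (hψ.indicator measurableSet_Ioc) (indicator_le_weight hT hB hB0)]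
  exact setIntegral_congr_fun measurableSet_Ioi fun u hu => by
    simp only [tsum_indicator_dilate ψ hu hT]

theorem integral_Ioc_mul_K (hf : Admissible f) (hψ : Measurable ψ) (hT : 0 ≤ T)
    (hB : ∀ t ∈ Ioc 0 T, ‖ψ t‖ ≤ B) (hB0 : 0 ≤ B) :
    ∫ t in Ioc 0 T, ψ t * K f t = ∫ u in Ioi (0 : ℝ), f u *
      (∑ n ∈ Finset.range ⌊T / u⌋₊, ψ (((n : ℝ) + 1) * u) -
        (∫ t in Ioc 0 T, ψ t) / (u : ℂ)) := by
  rw [← setIntegral_Ioi_indicator, ← indicator_mul_eq,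
    integral_mul_K hf (hψ.indicator measurableSet_Ioc) (indicator_le_weight hT hB hB0)]
  refine setIntegral_congr_fun measurableSet_Ioi fun u hu => ?_
  simp only [tsum_indicator_dilate ψ hu hT, setIntegral_Ioi_indicator]

end Truncation

theorem integrableOn_Ioc_K {f : ℝ → ℂ} (hf : Admissible f) (a b : ℝ) :
    IntegrableOn (K f) (Ioc a b) :=
  ((locallyIntegrable_K hf).integrableOn_isCompact isCompact_Icc).mono_set Ioc_subset_Icc_self

theorem integrableOn_Ioc_F {f : ℝ → ℂ} (hf : Admissible f) (a b : ℝ) :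
    IntegrableOn (F f) (Ioc a b) := by
  rw [F_eq_K_inversion]
  exact integrableOn_Ioc_K hf.inversion a b

/-! ### The sine transform of `K` and the primitive of `F` -/

section SineTransform

variable {f : ℝ → ℂ}

/-- `∫_0^T sin(2πxt)/(πt) K(t) dt`. -/
noncomputable def sineTransform (f : ℝ → ℂ) (T x : ℝ) : ℂ :=
  ∫ t in Ioc 0 T, (dirichletKernel x t : ℂ) * K f t

theorem sineTransform_eq (hf : Admissible f) {T : ℝ} (hT : 0 ≤ T) (x : ℝ) :
    sineTransform f T x = ∫ u in Ioi (0 : ℝ), ((sineSum ⌊T / u⌋₊ (x * u) -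
      sineIntegral (2 * π * x * T) / π : ℝ) : ℂ) * (f u / (u : ℂ)) := by
  have hm := (continuous_dirichletKernel x).measurable
  rw [sineTransform, integral_Ioc_mul_K hf (B := 2 * |x|) (by fun_prop) hT (fun t _ => by
    rw [Complex.norm_real]; exact abs_dirichletKernel_le x t) (by positivity)]
  refine setIntegral_congr_fun measurableSet_Ioi fun u hu => ?_
  have hi : ∫ t in Ioc 0 T, (dirichletKernel x t : ℂ) =
      ((sineIntegral (2 * π * x * T) / π : ℝ) : ℂ) := by
    rw [integral_complex_ofReal, ← intervalIntegral.integral_of_le hT, integral_dirichletKernel]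
    simp [sineIntegral]
  have hu' : (u : ℂ) ≠ 0 := by exact_mod_cast (ne_of_gt hu : u ≠ 0)
  simp only [hi]
  rw [← Complex.ofReal_sum, sum_dirichletKernel _ _ hu]
  push_cast
  field_simp

theorem measurable_sineSum_floor (T x : ℝ) :
    Measurable fun u : ℝ => sineSum ⌊T / u⌋₊ (x * u) := by
  have hu : Measurable fun p : ℕ × ℝ => sineSum p.1 p.2 :=
    measurable_from_prod_countable_right fun N => (continuous_sineSum N).measurable
  have hT : Measurable fun u : ℝ => (⌊T / u⌋₊, x * u) :=
    Measurable.prodMk (Nat.measurable_floor.comp (by fun_prop)) (by fun_prop)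
  have h := hu.comp hT
  simpa only [Function.comp_def] using h

theorem abs_sineSum_sub_le (N : ℕ) (y z : ℝ) : |sineSum N y - sineIntegral z / π| ≤ 8 := by
  have h1 := abs_sineSum_le N y
  have h2 : |sineIntegral z / π| ≤ 3 := by
    rw [abs_div, abs_of_pos Real.pi_pos, div_le_iff₀ Real.pi_pos]
    nlinarith [abs_sineIntegral_le z, Real.pi_gt_three]
  rw [abs_le] at *
  constructor <;> linarith [h1.1, h1.2, h2.1, h2.2]

theorem norm_sineTransform_le (hf : Admissible f) {T : ℝ} (hT : 0 ≤ T) (x : ℝ) :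
    ‖sineTransform f T x‖ ≤ ∫ u in Ioi (0 : ℝ), 8 * ‖f u / (u : ℂ)‖ := by
  rw [sineTransform_eq hf hT]
  refine norm_integral_le_of_norm_le (hf.int_div.norm.const_mul 8) (Eventually.of_forall fun u => ?_)
  rw [norm_mul, Complex.norm_real]
  exact mul_le_mul_of_nonneg_right (abs_sineSum_sub_le _ _ _) (norm_nonneg _)

/-- `∫_0^x F`. -/
noncomputable def primitiveF (f : ℝ → ℂ) (x : ℝ) : ℂ := ∫ y in Ioc 0 x, F f y

/-- With test function `1` on `(0, x]` and after inversion, the sum counts `⌊xu⌋` and the subtracted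
integral gives `xu`. -/
theorem primitiveF_eq (hf : Admissible f) {x : ℝ} (hx : 0 ≤ x) :
    primitiveF f x = ∫ u in Ioi (0 : ℝ), ((-Int.fract (x * u) : ℝ) : ℂ) * (f u / (u : ℂ)) := by
  have h := integral_Ioc_mul_K hf.inversion (ψ := fun _ => 1) (B := 1) measurable_const hx
    (fun t _ => by simp) zero_le_one
  simp only [one_mul] at h
  rw [primitiveF, F_eq_K_inversion, h, ← integral_comp_inv_Ioi]
  refine setIntegral_congr_fun measurableSet_Ioi fun u hu => ?_
  have hu : 0 < u := hu
  have hu' : (u : ℂ) ≠ 0 := by exact_mod_cast hu.ne'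
  have hi : ∫ _ in Ioc 0 x, (1 : ℂ) = x := by simp [hx]
  have hfl : ((⌊x * u⌋₊ : ℝ)) = x * u - Int.fract (x * u) := by
    rw [natCast_floor_eq_intCast_floor (by positivity), Int.self_sub_fract]
  have hfl' : ((⌊x * u⌋₊ : ℂ)) = x * u - (Int.fract (x * u) : ℝ) := by exact_mod_cast hfl
  simp only [hi, Complex.real_smul, inversion, inv_inv, abs_of_pos (inv_pos.2 hu), div_inv_eq_mul,
    Finset.sum_const, Finset.card_range, nsmul_eq_mul, mul_one, hfl']
  push_cast
  field_simp
  ring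

theorem tendsto_sineTransform (hf : Admissible f) {x : ℝ} (hx : 0 ≤ x) :
    Tendsto (fun T => sineTransform f T x) atTop (𝓝 (primitiveF f x)) := by
  rw [primitiveF_eq hf hx]
  have hev : ∀ᶠ T : ℝ in atTop, sineTransform f T x = ∫ u in Ioi (0 : ℝ),
      ((sineSum ⌊T / u⌋₊ (x * u) - sineIntegral (2 * π * x * T) / π : ℝ) : ℂ) *
        (f u / (u : ℂ)) := by
    filter_upwards [eventually_ge_atTop 0] with T hT using sineTransform_eq hf hT x
  rw [tendsto_congr' hev]
  refine tendsto_integral_filter_of_dominated_convergence (fun u => 8 * ‖f u / (u : ℂ)‖)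
    (Eventually.of_forall fun T => ?_) (Eventually.of_forall fun T => Eventually.of_forall fun u => ?_)
    (hf.int_div.norm.const_mul 8) ?_
  · refine AEStronglyMeasurable.mul (Measurable.aestronglyMeasurable ?_) hf.int_div.1
    exact Complex.measurable_ofReal.comp ((measurable_sineSum_floor T x).sub_const _)
  · rw [norm_mul, Complex.norm_real]
    exact mul_le_mul_of_nonneg_right (abs_sineSum_sub_le _ _ _) (norm_nonneg _)
  · rcases hx.eq_or_lt with rfl | hx
    -- At `x = 0` everything vanishes; the pointwise limits below need `x > 0`.
    · refine Eventually.of_forall fun u => ?_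
      simp [sineSum, sineIntegral]
    filter_upwards [ae_restrict_of_ae (ae_fract_mul_ne_zero hx.ne'),
      ae_restrict_mem measurableSet_Ioi] with u hu hu0
    have hN : Tendsto (fun T : ℝ => ⌊T / u⌋₊) atTop atTop :=
      tendsto_nat_floor_atTop.comp (tendsto_id.atTop_div_const hu0)
    have hS := (tendsto_sineSum hu).comp hN
    have hI : Tendsto (fun T : ℝ => sineIntegral (2 * π * x * T)) atTop (𝓝 (π / 2)) :=
      tendsto_sineIntegral.comp (tendsto_id.const_mul_atTop (by positivity))
    have h := hS.sub (hI.div_const π)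
    have e : 1 / 2 - Int.fract (x * u) - π / 2 / π = -Int.fract (x * u) := by
      have := Real.pi_pos.ne'
      field_simp
      ring
    rw [e] at h
    exact ((Complex.continuous_ofReal.tendsto _).comp h).mul_const _

/-- The primitive of `F` tends to `K(0)/2`. -/
theorem tendsto_primitiveF (hf : Admissible f) :
    Tendsto (primitiveF f) atTop (𝓝 (K f 0 / 2)) := by
  have h := tendsto_integral_sawtooth ((integrable_indicator_iff measurableSet_Ioi).2 hf.int_div)
  -- Writing `-{xu}` as the sawtooth minus `1/2`, only the mean contributes in the limit.
  have h2 := h.sub_const (moment f / 2)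
  rw [zero_sub, ← neg_div, ← K_zero] at h2
  refine h2.congr' ?_
  filter_upwards [eventually_ge_atTop 0] with x hx
  have e : ∫ t, ((1 / 2 - Int.fract (x * t) : ℝ) : ℂ) *
      (Ioi 0).indicator (fun u : ℝ => f u / (u : ℂ)) t =
      ∫ t in Ioi (0 : ℝ), ((1 / 2 - Int.fract (x * t) : ℝ) : ℂ) * (f t / (t : ℂ)) := by
    rw [← integral_indicator measurableSet_Ioi]
    congr 1
    funext t
    by_cases ht : t ∈ Ioi (0 : ℝ)
    · simp only [indicator_of_mem ht]
    · simp only [indicator_of_notMem ht, mul_zero]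
  have hint : IntegrableOn (fun t => ((1 / 2 - Int.fract (x * t) : ℝ) : ℂ) * (f t / (t : ℂ)))
      (Ioi 0) :=
    hf.int_div.bdd_mul (c := 1) (Measurable.aestronglyMeasurable (by fun_prop))
      (Eventually.of_forall fun t => by rw [Complex.norm_real]; exact abs_sawtooth_le _)
  rw [e, primitiveF_eq hf hx, moment, ← integral_div, ← integral_sub hint (hf.int_div.div_const 2)]
  refine setIntegral_congr_fun measurableSet_Ioi fun u _ => ?_
  push_cast
  ring

end SineTransform

/-! ### Passing to frequency `ξ` by integration by parts -/

section CosineKernel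

theorem hasDerivAt_dirichletKernel (t x : ℝ) :
    HasDerivAt (fun x => dirichletKernel x t) (2 * Real.cos (2 * π * t * x)) x := by
  by_cases ht : t = 0
  · subst ht
    simp only [dirichletKernel, if_true]
    simpa using (hasDerivAt_id x).const_mul (2 : ℝ)
  · simp_rw [dirichletKernel_of_ne_zero _ ht]
    have h := (((hasDerivAt_id x).const_mul (2 * π)).mul_const t).sin.div_const (π * t)
    refine h.congr_deriv ?_
    have := Real.pi_pos.ne'
    simp only [id_eq, mul_one]
    rw [show 2 * π * t * x = 2 * π * x * t by ring]
    field_simp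

theorem hasDerivAt_cosine (ξ x : ℝ) :
    HasDerivAt (fun x => 2 * Real.cos (2 * π * ξ * x)) (-(4 * π * ξ * Real.sin (2 * π * ξ * x))) x := by
  have h := ((hasDerivAt_id x).const_mul (2 * π * ξ)).cos.const_mul 2
  refine h.congr_deriv ?_
  simp only [id_eq, mul_one]
  ring

theorem integral_cosine (s Λ : ℝ) :
    ∫ x in (0 : ℝ)..Λ, 2 * Real.cos (2 * π * s * x) = dirichletKernel Λ s := by
  rw [intervalIntegral.integral_eq_sub_of_hasDerivAt (fun x _ => hasDerivAt_dirichletKernel s x)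
    (Continuous.intervalIntegrable (by fun_prop) _ _)]
  simp [dirichletKernel]

/-- The left side is `∫_0^Λ 2cos(2πξx) 2cos(2πtx) dx`, integrated by parts using that the kernel is
the primitive in `x` of `2cos(2πtx)`. -/
theorem dirichletKernel_add_eq (Λ ξ t : ℝ) :
    dirichletKernel Λ (t - ξ) + dirichletKernel Λ (t + ξ) =
      2 * Real.cos (2 * π * ξ * Λ) * dirichletKernel Λ t -
        ∫ x in (0 : ℝ)..Λ, -(4 * π * ξ * Real.sin (2 * π * ξ * x)) * dirichletKernel x t := by
  have hparts := intervalIntegral.integral_mul_deriv_eq_deriv_mul (a := 0) (b := Λ)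
    (fun x _ => hasDerivAt_cosine ξ x) (fun x _ => hasDerivAt_dirichletKernel t x)
    (Continuous.intervalIntegrable (by fun_prop) _ _)
    (Continuous.intervalIntegrable (by fun_prop) _ _)
  have h0 : dirichletKernel 0 t = 0 := by simp [dirichletKernel]
  rw [h0, mul_zero, sub_zero] at hparts
  rw [← hparts, ← integral_cosine, ← integral_cosine, ← intervalIntegral.integral_add
    (Continuous.intervalIntegrable (by fun_prop) _ _)
    (Continuous.intervalIntegrable (by fun_prop) _ _)]
  refine intervalIntegral.integral_congr fun x _ => ?_
  rw [show 2 * π * (t - ξ) * x = 2 * π * t * x - 2 * π * ξ * x by ring,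
    show 2 * π * (t + ξ) * x = 2 * π * t * x + 2 * π * ξ * x by ring, Real.cos_sub, Real.cos_add]
  ring

end CosineKernel

section Cosine

variable {f : ℝ → ℂ}

/-- The derivative of the cosine `2 cos(2πξx)`, with complex values. -/
noncomputable def cosineDeriv (ξ x : ℝ) : ℂ := ((-(4 * π * ξ * Real.sin (2 * π * ξ * x)) : ℝ) : ℂ)

theorem continuous_cosineDeriv (ξ : ℝ) : Continuous (cosineDeriv ξ) := by
  unfold cosineDeriv; fun_prop

theorem norm_cosineDeriv_le (ξ x : ℝ) : ‖cosineDeriv ξ x‖ ≤ 4 * π * |ξ| := by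
  rw [cosineDeriv, Complex.norm_real, norm_neg, norm_mul, norm_mul,
    Real.norm_of_nonneg (by positivity), Real.norm_eq_abs]
  exact mul_le_of_le_one_right (by positivity) (Real.abs_sin_le_one _)

theorem integrable_cosineDeriv_kernel_K (hf : Admissible f) (T Λ ξ : ℝ) :
    Integrable (fun p : ℝ × ℝ => cosineDeriv ξ p.1 * ((dirichletKernel p.1 p.2 : ℂ) * K f p.2))
      ((volume.restrict (Ioc 0 Λ)).prod (volume.restrict (Ioc 0 T))) := by
  have hK : Integrable (fun p : ℝ × ℝ => K f p.2)
      ((volume.restrict (Ioc 0 Λ)).prod (volume.restrict (Ioc 0 T))) :=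
    Integrable.comp_snd (integrableOn_Ioc_K hf 0 T) _
  have hd := continuous_dirichletKernel_uncurry
  have hc := continuous_cosineDeriv ξ
  have hmem : ∀ᵐ p ∂((volume.restrict (Ioc 0 Λ)).prod (volume.restrict (Ioc (0 : ℝ) T))),
      p ∈ Ioc 0 Λ ×ˢ Ioc 0 T := by
    rw [Measure.prod_restrict]
    exact ae_restrict_mem (measurableSet_Ioc.prod measurableSet_Ioc)
  refine (hK.bdd_mul (f := fun p : ℝ × ℝ => cosineDeriv ξ p.1 * (dirichletKernel p.1 p.2 : ℂ))
    (c := 4 * π * |ξ| * (2 * |Λ|)) (Continuous.aestronglyMeasurable (by fun_prop)) ?_).congr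
    (Eventually.of_forall fun p => mul_assoc _ _ _)
  filter_upwards [hmem] with p hp
  rw [norm_mul, Complex.norm_real]
  refine mul_le_mul (norm_cosineDeriv_le _ _) ((abs_dirichletKernel_le _ _).trans ?_)
    (norm_nonneg _) (by positivity)
  have h := hp.1
  rw [abs_of_pos h.1, abs_of_pos (h.1.trans_le h.2)]
  linarith [h.2]

theorem integral_cosineKernel_mul_K (hf : Admissible f) (T ξ : ℝ) {Λ : ℝ} (hΛ : 0 ≤ Λ) :
    ∫ t in Ioc 0 T, ((dirichletKernel Λ (t - ξ) + dirichletKernel Λ (t + ξ) : ℝ) : ℂ) * K f t =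
      ((2 * Real.cos (2 * π * ξ * Λ) : ℝ) : ℂ) * sineTransform f T Λ -
        ∫ x in Ioc 0 Λ, cosineDeriv ξ x * sineTransform f T x := by
  have hprod := integrable_cosineDeriv_kernel_K hf T Λ ξ
  have hswap := integral_integral_swap (μ := volume.restrict (Ioc 0 Λ))
    (ν := volume.restrict (Ioc 0 T))
    (f := fun x t => cosineDeriv ξ x * ((dirichletKernel x t : ℂ) * K f t)) hprod
  have hint := hprod.integral_prod_right
  simp_rw [sineTransform, ← integral_const_mul]
  rw [hswap]
  have h1 : IntegrableOn (fun t => ((2 * Real.cos (2 * π * ξ * Λ) : ℝ) : ℂ) *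
      ((dirichletKernel Λ t : ℂ) * K f t)) (Ioc 0 T) := by
    refine Integrable.const_mul ((integrableOn_Ioc_K hf 0 T).bdd_mul (c := 2 * |Λ|) ?_ ?_) _
    · have := continuous_dirichletKernel Λ
      exact Continuous.aestronglyMeasurable (by fun_prop)
    · exact Eventually.of_forall fun t => by
        rw [Complex.norm_real]; exact abs_dirichletKernel_le _ _
  rw [← integral_sub h1 hint]
  refine integral_congr_ae (Eventually.of_forall fun t => ?_)
  have e : ∫ x in Ioc 0 Λ, cosineDeriv ξ x * ((dirichletKernel x t : ℂ) * K f t) =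
      ((∫ x in (0 : ℝ)..Λ, -(4 * π * ξ * Real.sin (2 * π * ξ * x)) * dirichletKernel x t : ℝ) : ℂ) *
        K f t := by
    rw [← intervalIntegral.integral_ofReal, intervalIntegral.integral_of_le hΛ,
      ← integral_mul_const]
    refine integral_congr_ae (Eventually.of_forall fun x => ?_)
    simp only [cosineDeriv]
    push_cast
    ring
  simp only [e]
  rw [dirichletKernel_add_eq]
  push_cast
  ring

/-- Integration by parts for a merely integrable `F`, carried out as Fubini on the triangle `y ≤ x ≤
Λ`. It has the same shape as `integral_cosineKernel_mul_K`, with the primitive in place of the sine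
transform. -/
theorem integral_cosine_mul_F (hf : Admissible f) (ξ Λ : ℝ) :
    ∫ x in Ioc 0 Λ, ((2 * Real.cos (2 * π * ξ * x) : ℝ) : ℂ) * F f x =
      ((2 * Real.cos (2 * π * ξ * Λ) : ℝ) : ℂ) * primitiveF f Λ -
        ∫ x in Ioc 0 Λ, cosineDeriv ξ x * primitiveF f x := by
  have hF := integrableOn_Ioc_F hf 0 Λ
  have hc := continuous_cosineDeriv ξ
  let k : ℝ → ℝ → ℂ := fun x y => ({p : ℝ × ℝ | p.2 ≤ p.1}.indicator
    (fun p => cosineDeriv ξ p.1 * F f p.2)) (x, y)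
  have hprod : Integrable (Function.uncurry k)
      ((volume.restrict (Ioc 0 Λ)).prod (volume.restrict (Ioc 0 Λ))) := by
    refine Integrable.indicator ?_ (measurableSet_le measurable_snd measurable_fst)
    refine Integrable.bdd_mul (c := 4 * π * |ξ|) (Integrable.comp_snd hF _)
      (Continuous.aestronglyMeasurable (by fun_prop))
      (Eventually.of_forall fun p => norm_cosineDeriv_le _ _)
  have hswap := integral_integral_swap hprod
  have hint : IntegrableOn (fun y => ∫ x in Ioc 0 Λ, k x y) (Ioc 0 Λ) := hprod.integral_prod_right
  have e1 : ∫ x in Ioc 0 Λ, cosineDeriv ξ x * primitiveF f x =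
      ∫ x in Ioc 0 Λ, ∫ y in Ioc 0 Λ, k x y := by
    refine setIntegral_congr_fun measurableSet_Ioc fun x hx => ?_
    simp only [primitiveF, ← integral_const_mul]
    have : (fun y => k x y) = (Iic x).indicator fun y => cosineDeriv ξ x * F f y := by
      funext y
      by_cases hy : y ≤ x <;> simp [k, hy]
    rw [this, setIntegral_indicator measurableSet_Iic]
    congr 2
    ext y
    simp only [mem_Ioc, mem_inter_iff, mem_Iic]
    exact ⟨fun h => ⟨⟨h.1, h.2.trans hx.2⟩, h.2⟩, fun h => ⟨h.1.1, h.2⟩⟩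
  have e2 : EqOn (fun y => ∫ x in Ioc 0 Λ, k x y) (fun y =>
      (((2 * Real.cos (2 * π * ξ * Λ) - 2 * Real.cos (2 * π * ξ * y)) : ℝ) : ℂ) * F f y)
      (Ioc 0 Λ) := by
    intro y hy
    have : (fun x => k x y) = (Ici y).indicator fun x => cosineDeriv ξ x * F f y := by
      funext x
      by_cases hxy : y ≤ x <;> simp [k, hxy]
    simp only [this]
    rw [setIntegral_indicator measurableSet_Ici]
    have hset : Ioc 0 Λ ∩ Ici y = Icc y Λ := by
      ext x
      simp only [mem_Ioc, mem_inter_iff, mem_Ici, mem_Icc]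
      exact ⟨fun h => ⟨h.2, h.1.2⟩, fun h => ⟨⟨hy.1.trans_le h.1, h.2⟩, h.1⟩⟩
    rw [hset, integral_Icc_eq_integral_Ioc, integral_mul_const]
    congr 1
    simp only [cosineDeriv]
    rw [integral_complex_ofReal, ← intervalIntegral.integral_of_le hy.2,
      intervalIntegral.integral_eq_sub_of_hasDerivAt (fun x _ => hasDerivAt_cosine ξ x)
        (Continuous.intervalIntegrable (by fun_prop) _ _)]
  rw [e1, hswap, primitiveF, ← integral_const_mul, ← integral_sub (hF.const_mul _) hint]
  refine setIntegral_congr_fun measurableSet_Ioc fun y hy => ?_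
  have := e2 hy
  simp only at this
  simp only [this]
  push_cast
  ring

/-- The truncated cosine transform of `F` as an improper integral of `K`. -/
theorem tendsto_integral_cosineKernel_mul_K (hf : Admissible f) (ξ : ℝ) {Λ : ℝ} (hΛ : 0 ≤ Λ) :
    Tendsto (fun T => ∫ t in Ioc 0 T,
      ((dirichletKernel Λ (t - ξ) + dirichletKernel Λ (t + ξ) : ℝ) : ℂ) * K f t) atTop
      (𝓝 (∫ x in Ioc 0 Λ, ((2 * Real.cos (2 * π * ξ * x) : ℝ) : ℂ) * F f x)) := by
  simp_rw [integral_cosineKernel_mul_K hf _ ξ hΛ, integral_cosine_mul_F hf ξ Λ]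
  -- The sine transforms converge pointwise to the primitive and are bounded uniformly in `T` and
  -- `x`, so the limit passes under the integral over `(0, Λ]`.
  refine ((tendsto_sineTransform hf hΛ).const_mul _).sub ?_
  refine tendsto_integral_filter_of_dominated_convergence
    (fun _ => 4 * π * |ξ| * ∫ u in Ioi (0 : ℝ), 8 * ‖f u / (u : ℂ)‖) ?_ ?_
    (integrable_const _) ?_
  · refine Eventually.of_forall fun T => ?_
    have := (integrable_cosineDeriv_kernel_K hf T Λ ξ).integral_prod_left.1
    simp_rw [integral_const_mul] at this
    exact this
  · filter_upwards [eventually_ge_atTop 0] with T hT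
    refine Eventually.of_forall fun x => ?_
    rw [norm_mul]
    exact mul_le_mul (norm_cosineDeriv_le _ _) (norm_sineTransform_le hf hT x) (norm_nonneg _)
      (by positivity)
  · filter_upwards [ae_restrict_mem measurableSet_Ioc] with x hx
    exact (tendsto_sineTransform hf hx.1.le).const_mul _

end Cosine

/-! ### Localization as `Λ → ∞` -/

section Localization

variable {f : ℝ → ℂ}

theorem sineSum_integral_tendsto {φ : ℝ → ℂ} {s : Set ℝ} (hs : MeasurableSet s)
    (hφ : IntegrableOn φ s) (N : ℕ) :
    Tendsto (fun Λ : ℝ => ∫ u in s, ((sineSum N (Λ * u) : ℝ) : ℂ) * φ u) atTop (𝓝 0) := by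
  have hterm (n : ℕ) : Tendsto (fun Λ : ℝ => ((1 / (π * ((n : ℝ) + 1)) : ℝ) : ℂ) *
      ∫ u in s, ((Real.sin (2 * π * (((n : ℝ) + 1) * Λ) * (u - 0)) : ℝ) : ℂ) * φ u)
      atTop (𝓝 0) := by
    have hn : Tendsto (fun Λ : ℝ => ((n : ℝ) + 1) * Λ) atTop atTop :=
      tendsto_id.const_mul_atTop (by positivity)
    simpa using ((tendsto_setIntegral_sin_sub_mul hs hφ 0).comp hn).const_mul
      ((1 / (π * ((n : ℝ) + 1)) : ℝ) : ℂ)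
  have hsum := tendsto_finsetSum (Finset.range N) fun n _ => hterm n
  simp only [Finset.sum_const_zero] at hsum
  refine hsum.congr fun Λ => ?_
  simp_rw [← integral_const_mul]
  rw [← integral_finsetSum]
  · refine integral_congr_ae (Eventually.of_forall fun u => ?_)
    simp only [sineSum, Complex.ofReal_sum, Finset.sum_mul]
    refine Finset.sum_congr rfl fun n _ => ?_
    rw [show 2 * π * ((n : ℝ) + 1) * (Λ * u) = 2 * π * (((n : ℝ) + 1) * Λ) * (u - 0) by ring]
    push_cast
    ring
  · intro n _
    refine Integrable.const_mul (hφ.bdd_mul (c := 1) ?_ ?_) _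
    · exact Continuous.aestronglyMeasurable (by fun_prop)
    · exact Eventually.of_forall fun t => by
        rw [Complex.norm_real]; exact Real.abs_sin_le_one _

/-- The origin is a point of vanishing Dirichlet value for co-sums. -/
theorem tendsto_kernel_mul_coSum (hf : Admissible f) {X : ℝ} (hX : 0 ≤ X) :
    Tendsto (fun Λ : ℝ => ∫ t in Ioc 0 X, (dirichletKernel Λ t : ℂ) * coSum f t) atTop (𝓝 0) := by
  -- On each cell the number of harmonics is fixed, so Riemann-Lebesgue applies there. The cell
  -- integrals are dominated by `5 ∫ |f(u)/u|` over the cell, which is summable.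
  let A : ℕ → Set ℝ := fun N => Ioi 0 ∩ {u | ⌊X / u⌋₊ = N}
  have hA (N : ℕ) : MeasurableSet (A N) :=
    measurableSet_Ioi.inter ((Nat.measurable_floor.comp (by fun_prop : Measurable fun u : ℝ => X / u))
      (measurableSet_singleton N))
  have hU : Ioi (0 : ℝ) = ⋃ N, A N := by
    ext u
    simp [A]
  have hdisj : Pairwise (Function.onFun Disjoint A) := fun M N hMN =>
    Set.disjoint_left.2 fun u hM hN => hMN (hM.2.symm.trans hN.2)
  have hsub (N : ℕ) : A N ⊆ Ioi 0 := inter_subset_left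
  have hpair (Λ : ℝ) : ∫ t in Ioc 0 X, (dirichletKernel Λ t : ℂ) * coSum f t =
      ∫ u in Ioi (0 : ℝ), ((sineSum ⌊X / u⌋₊ (Λ * u) : ℝ) : ℂ) * (f u / (u : ℂ)) := by
    have hm := (continuous_dirichletKernel Λ).measurable
    rw [integral_Ioc_mul_coSum hf (B := 2 * |Λ|) (by fun_prop) hX (fun t _ => by
      rw [Complex.norm_real]; exact abs_dirichletKernel_le Λ t) (by positivity)]
    refine setIntegral_congr_fun measurableSet_Ioi fun u hu => ?_
    rw [← Complex.ofReal_sum, sum_dirichletKernel _ _ hu]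
    push_cast
    ring
  have hint (Λ : ℝ) : IntegrableOn
      (fun u : ℝ => ((sineSum ⌊X / u⌋₊ (Λ * u) : ℝ) : ℂ) * (f u / (u : ℂ))) (Ioi 0) := by
    refine hf.int_div.bdd_mul (c := 5) (Measurable.aestronglyMeasurable ?_)
      (Eventually.of_forall fun u => by rw [Complex.norm_real]; exact abs_sineSum_le _ _)
    exact Complex.measurable_ofReal.comp (measurable_sineSum_floor X Λ)
  have hcell (Λ : ℝ) (N : ℕ) :
      ∫ u in A N, ((sineSum ⌊X / u⌋₊ (Λ * u) : ℝ) : ℂ) * (f u / (u : ℂ)) =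
        ∫ u in A N, ((sineSum N (Λ * u) : ℝ) : ℂ) * (f u / (u : ℂ)) :=
    setIntegral_congr_fun (hA N) fun u hu => by
      have : ⌊X / u⌋₊ = N := hu.2
      simp only [this]
  have hdecomp (Λ : ℝ) : ∫ t in Ioc 0 X, (dirichletKernel Λ t : ℂ) * coSum f t =
      ∑' N, ∫ u in A N, ((sineSum N (Λ * u) : ℝ) : ℂ) * (f u / (u : ℂ)) := by
    have h := hasSum_integral_iUnion hA hdisj (by rw [← hU]; exact hint Λ)
    rw [hpair]
    conv_lhs => rw [hU]
    rw [← h.tsum_eq]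
    exact tsum_congr fun N => hcell Λ N
  have hbound : Summable fun N => ∫ u in A N, 5 * ‖f u / (u : ℂ)‖ :=
    (hasSum_integral_iUnion hA hdisj (by rw [← hU]; exact hf.int_div.norm.const_mul 5)).summable
  simp_rw [hdecomp]
  have h := tendsto_tsum_of_dominated_convergence hbound
    (fun N => sineSum_integral_tendsto (hA N) (hf.int_div.mono_set (hsub N)) N)
    (Eventually.of_forall fun Λ N => ?_)
  · simpa using h
  · refine norm_integral_le_of_norm_le ((hf.int_div.mono_set (hsub N)).norm.const_mul 5)
      (Eventually.of_forall fun u => ?_)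
    rw [norm_mul, Complex.norm_real]
    exact mul_le_mul_of_nonneg_right (abs_sineSum_le _ _) (norm_nonneg _)

theorem integrableOn_kernel_mul {φ : ℝ → ℂ} {s : Set ℝ} (hφ : IntegrableOn φ s) (Λ ξ : ℝ) :
    IntegrableOn (fun t => (dirichletKernel Λ (t - ξ) : ℂ) * φ t) s := by
  refine hφ.bdd_mul (c := 2 * |Λ|) ?_ (Eventually.of_forall fun t => by
    rw [Complex.norm_real]; exact abs_dirichletKernel_le _ _)
  have := continuous_dirichletKernel Λ
  exact Continuous.aestronglyMeasurable (by fun_prop)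

theorem integral_kernel_mul_K (hf : Admissible f) {X : ℝ} (hX : 0 ≤ X) (Λ ξ : ℝ) :
    ∫ t in Ioc 0 X, (dirichletKernel Λ (t - ξ) : ℂ) * K f t =
      (∫ t in Ioc 0 X, (dirichletKernel Λ (t - ξ) : ℂ) * coSum f t) -
        ((∫ t in (0 : ℝ)..X, dirichletKernel Λ (t - ξ) : ℝ) : ℂ) * moment f := by
  rw [← intervalIntegral.integral_ofReal, intervalIntegral.integral_of_le hX, ← integral_mul_const]
  have hc : IntegrableOn (fun t => (dirichletKernel Λ (t - ξ) : ℂ) * moment f) (Ioc 0 X) :=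
    integrableOn_kernel_mul (φ := fun _ => moment f) continuous_const.integrableOn_Ioc Λ ξ
  rw [← integral_sub (integrableOn_kernel_mul (integrableOn_Ioc_coSum hf X) Λ ξ) hc]
  refine setIntegral_congr_fun measurableSet_Ioc fun t ht => ?_
  simp only [K_of_ne_zero f ht.1.ne', mul_sub]

theorem tendsto_sineIntegral_scale {X : ℝ} (hX : 0 < X) :
    Tendsto (fun Λ : ℝ => sineIntegral (2 * π * Λ * X)) atTop (𝓝 (π / 2)) :=
  tendsto_sineIntegral.comp
    ((tendsto_id.const_mul_atTop (by positivity)).atTop_mul_const hX)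

theorem integral_kernel_sub (Λ ξ X : ℝ) :
    ∫ t in (0 : ℝ)..X, dirichletKernel Λ (t - ξ) =
      (sineIntegral (2 * π * Λ * (X - ξ)) + sineIntegral (2 * π * Λ * ξ)) / π := by
  rw [intervalIntegral.integral_comp_sub_right, integral_dirichletKernel, zero_sub, mul_neg,
    sineIntegral_neg, sub_neg_eq_add]

theorem tendsto_integral_kernel_zero {X : ℝ} (hX : 0 < X) :
    Tendsto (fun Λ : ℝ => ∫ t in (0 : ℝ)..X, dirichletKernel Λ (t - 0)) atTop (𝓝 (1 / 2)) := by
  simp_rw [integral_kernel_sub]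
  have h := (tendsto_sineIntegral_scale hX).div_const π
  have e : π / 2 / π = 1 / 2 := by have := Real.pi_pos.ne'; field_simp
  rw [e] at h
  simpa [sineIntegral] using h

theorem tendsto_integral_kernel {ξ X : ℝ} (hξ : 0 < ξ) (hX : ξ < X) :
    Tendsto (fun Λ : ℝ => ∫ t in (0 : ℝ)..X, dirichletKernel Λ (t - ξ)) atTop (𝓝 1) := by
  simp_rw [integral_kernel_sub]
  have h := ((tendsto_sineIntegral_scale (sub_pos.2 hX)).add
    (tendsto_sineIntegral_scale hξ)).div_const π
  have e : (π / 2 + π / 2) / π = 1 := by have := Real.pi_pos.ne'; field_simp; norm_num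
  rwa [e] at h

/-- The co-sum contributes nothing, and the constant `-moment f` meets half the mass of the kernel.
-/
theorem tendsto_kernel_mul_K_zero (hf : Admissible f) {X : ℝ} (hX : 0 < X) :
    Tendsto (fun Λ : ℝ => ∫ t in Ioc 0 X, (dirichletKernel Λ (t - 0) : ℂ) * K f t) atTop
      (𝓝 (K f 0 / 2)) := by
  simp_rw [integral_kernel_mul_K hf hX.le]
  have h1 := tendsto_kernel_mul_coSum hf hX.le
  have h2 := ((Complex.continuous_ofReal.tendsto _).comp
    (tendsto_integral_kernel_zero hX)).mul_const (moment f)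
  have h := h1.sub h2
  rw [show (0 : ℂ) - ((1 / 2 : ℝ) : ℂ) * moment f = K f 0 / 2 by
    rw [K_zero]; push_cast; ring] at h
  simpa using h

theorem tendsto_kernel_mul_away {φ : ℝ → ℂ} {a b ξ : ℝ} (hφ : IntegrableOn φ (Icc a b))
    (hξ : ξ ∉ Icc a b) :
    Tendsto (fun Λ : ℝ => ∫ t in Ioc a b, (dirichletKernel Λ (t - ξ) : ℂ) * φ t) atTop (𝓝 0) := by
  have hne : ∀ t ∈ Icc a b, π * (t - ξ) ≠ 0 := fun t ht =>
    mul_ne_zero Real.pi_pos.ne' (sub_ne_zero.2 fun h => hξ (h ▸ ht))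
  have hc : ContinuousOn (fun t : ℝ => (((π * (t - ξ))⁻¹ : ℝ) : ℂ)) (Icc a b) :=
    Complex.continuous_ofReal.comp_continuousOn ((by fun_prop : ContinuousOn _ _).inv₀ hne)
  have hint : IntegrableOn (fun t : ℝ => (((π * (t - ξ))⁻¹ : ℝ) : ℂ) * φ t) (Ioc a b) :=
    (hφ.continuousOn_mul hc isCompact_Icc).mono_set Ioc_subset_Icc_self
  refine (tendsto_setIntegral_sin_sub_mul measurableSet_Ioc hint ξ).congr fun Λ => ?_
  refine setIntegral_congr_fun measurableSet_Ioc fun t ht => ?_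
  have h := hne t (Ioc_subset_Icc_self ht)
  rw [dirichletKernel_of_ne_zero _ (right_ne_zero_of_mul h), div_eq_mul_inv]
  push_cast
  ring

theorem tailCoeff_bound {η X : ℝ} (hX : |η| < X) : ∃ C : ℝ, ∀ t : ℝ, 0 < t →
    ‖(Ioi X).indicator (fun t => (((1 / (π * (t - η)) - 1 / (π * t)) : ℝ) : ℂ)) t‖ ≤
      C * weight t := by
  have hX0 : 0 < X := (abs_nonneg η).trans_lt hX
  have hd : 0 < X - |η| := sub_pos.2 hX
  have hpi := Real.pi_pos
  -- The difference equals `η/(πt(t - η))`. For `t > X` one has `t - η ≥ t(X - |η|)/X` and `(1 +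
  -- t)/t ≤ (1 + X)/X`, whence the constant.
  refine ⟨|η| * X / (π * (X - |η|)) * ((1 + X) / X) ^ 2, fun t ht => ?_⟩
  by_cases h : t ∈ Ioi X
  · have h' : X < t := h
    have hη := le_abs_self η
    have hpos : 0 < t - η := by linarith
    rw [indicator_of_mem h, Complex.norm_real, Real.norm_eq_abs, weight]
    have e : 1 / (π * (t - η)) - 1 / (π * t) = η / (π * (t * (t - η))) := by
      field_simp
      ring
    rw [e, abs_div, abs_of_pos (by positivity : 0 < π * (t * (t - η)))]
    have h1 : t * (X - |η|) / X ≤ t - η := by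
      rw [div_le_iff₀ hX0]
      nlinarith [mul_nonneg (abs_nonneg η) (sub_nonneg.2 h'.le)]
    have h2 : (1 + t) / t ≤ (1 + X) / X := by
      rw [div_le_div_iff₀ ht hX0]
      nlinarith
    calc |η| / (π * (t * (t - η))) ≤ |η| / (π * (t * (t * (X - |η|) / X))) := by
          gcongr
      _ = |η| * X / (π * (X - |η|)) * ((1 + t) / t) ^ 2 * ((1 + t) ^ 2)⁻¹ := by
          field_simp
      _ ≤ _ := by gcongr
  · rw [indicator_of_notMem h, norm_zero]
    have := weight_nonneg t
    positivity

theorem integrableOn_tailCoeff_mul_K (hf : Admissible f) {η X : ℝ} (hX : |η| < X) :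
    IntegrableOn (fun t => (((1 / (π * (t - η)) - 1 / (π * t)) : ℝ) : ℂ) * K f t) (Ioi X) := by
  obtain ⟨C, hC⟩ := tailCoeff_bound hX
  have hX0 : 0 < X := (abs_nonneg η).trans_lt hX
  have h := (integrableOn_mul_K hf (Measurable.indicator (by fun_prop) measurableSet_Ioi) hC).mono_set
    (Ioi_subset_Ioi hX0.le)
  refine h.congr_fun (fun t ht => ?_) measurableSet_Ioi
  simp only [indicator_of_mem ht]

/-- The part of the cosine kernel with quadratic decay. -/
noncomputable def tailKernel (Λ ξ t : ℝ) : ℝ :=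
  Real.sin (2 * π * Λ * (t - ξ)) * (1 / (π * (t - ξ)) - 1 / (π * t)) +
    Real.sin (2 * π * Λ * (t - -ξ)) * (1 / (π * (t - -ξ)) - 1 / (π * t))

theorem cosineKernel_eq_tail (Λ : ℝ) {ξ t : ℝ} (ht : |ξ| < t) :
    dirichletKernel Λ (t - ξ) + dirichletKernel Λ (t + ξ) =
      2 * Real.cos (2 * π * ξ * Λ) * dirichletKernel Λ t + tailKernel Λ ξ t := by
  have h1 := le_abs_self ξ
  have h2 := neg_abs_le ξ
  have h0 : 0 < t := (abs_nonneg ξ).trans_lt ht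
  rw [tailKernel, sub_neg_eq_add, dirichletKernel_of_ne_zero _ (by linarith : t - ξ ≠ 0),
    dirichletKernel_of_ne_zero _ (by linarith : t + ξ ≠ 0), dirichletKernel_of_ne_zero _ h0.ne']
  have e1 : Real.sin (2 * π * Λ * (t - ξ)) + Real.sin (2 * π * Λ * (t + ξ)) =
      2 * Real.cos (2 * π * ξ * Λ) * Real.sin (2 * π * Λ * t) := by
    rw [show 2 * π * Λ * (t - ξ) = 2 * π * Λ * t - 2 * π * ξ * Λ by ring,
      show 2 * π * Λ * (t + ξ) = 2 * π * Λ * t + 2 * π * ξ * Λ by ring, Real.sin_sub, Real.sin_add]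
    ring
  have e2 : 2 * Real.cos (2 * π * ξ * Λ) * (Real.sin (2 * π * Λ * t) / (π * t)) =
      (Real.sin (2 * π * Λ * (t - ξ)) + Real.sin (2 * π * Λ * (t + ξ))) * (1 / (π * t)) := by
    rw [e1]; ring
  rw [e2]
  ring

theorem tailKernel_mul_split (f : ℝ → ℂ) (Λ ξ t : ℝ) : (tailKernel Λ ξ t : ℂ) * K f t =
    ((Real.sin (2 * π * Λ * (t - ξ)) : ℝ) : ℂ) *
      ((((1 / (π * (t - ξ)) - 1 / (π * t)) : ℝ) : ℂ) * K f t) +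
    ((Real.sin (2 * π * Λ * (t - -ξ)) : ℝ) : ℂ) *
      ((((1 / (π * (t - -ξ)) - 1 / (π * t)) : ℝ) : ℂ) * K f t) := by
  rw [tailKernel]
  push_cast
  ring

theorem integrableOn_sin_mul {φ : ℝ → ℂ} {s : Set ℝ} (hφ : IntegrableOn φ s) (Λ ξ : ℝ) :
    IntegrableOn (fun t => ((Real.sin (2 * π * Λ * (t - ξ)) : ℝ) : ℂ) * φ t) s :=
  hφ.bdd_mul (c := 1) (Continuous.aestronglyMeasurable (by fun_prop))
    (Eventually.of_forall fun t => by rw [Complex.norm_real]; exact Real.abs_sin_le_one _)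

theorem integrableOn_tailKernel_mul_K (hf : Admissible f) {ξ X : ℝ} (hX : |ξ| < X) (Λ : ℝ) :
    IntegrableOn (fun t => (tailKernel Λ ξ t : ℂ) * K f t) (Ioi X) := by
  simp_rw [tailKernel_mul_split]
  exact (integrableOn_sin_mul (integrableOn_tailCoeff_mul_K hf hX) Λ ξ).add
    (integrableOn_sin_mul (integrableOn_tailCoeff_mul_K hf (by rwa [abs_neg])) Λ (-ξ))

theorem tendsto_integral_tailKernel_mul_K (hf : Admissible f) {ξ X : ℝ} (hX : |ξ| < X) :
    Tendsto (fun Λ => ∫ t in Ioi X, (tailKernel Λ ξ t : ℂ) * K f t) atTop (𝓝 0) := by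
  have h1 := integrableOn_tailCoeff_mul_K hf hX
  have h2 := integrableOn_tailCoeff_mul_K hf (η := -ξ) (X := X) (by rwa [abs_neg])
  have h := (tendsto_setIntegral_sin_sub_mul measurableSet_Ioi h1 ξ).add
    (tendsto_setIntegral_sin_sub_mul measurableSet_Ioi h2 (-ξ))
  rw [add_zero] at h
  refine h.congr fun Λ => ?_
  simp_rw [tailKernel_mul_split]
  rw [integral_add (integrableOn_sin_mul h1 Λ ξ) (integrableOn_sin_mul h2 Λ (-ξ))]

/-- Both sides are limits of the same integral over `(X, T]`. The conditionally convergent part is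
isolated in the unshifted kernel, whose improper integral beyond `X` is already known from the sine
transform. -/
theorem cosineTransform_sub_eq (hf : Admissible f) {ξ X Λ : ℝ} (hX : |ξ| < X) (hΛ : 0 ≤ Λ) :
    (∫ x in Ioc 0 Λ, ((2 * Real.cos (2 * π * ξ * x) : ℝ) : ℂ) * F f x) -
      (∫ t in Ioc 0 X, ((dirichletKernel Λ (t - ξ) + dirichletKernel Λ (t + ξ) : ℝ) : ℂ) * K f t) =
    ((2 * Real.cos (2 * π * ξ * Λ) : ℝ) : ℂ) * (primitiveF f Λ - sineTransform f X Λ) +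
      ∫ t in Ioi X, (tailKernel Λ ξ t : ℂ) * K f t := by
  have hX0 : 0 < X := (abs_nonneg ξ).trans_lt hX
  have hL := (tendsto_integral_cosineKernel_mul_K hf ξ hΛ).sub_const
    (∫ t in Ioc 0 X, ((dirichletKernel Λ (t - ξ) + dirichletKernel Λ (t + ξ) : ℝ) : ℂ) * K f t)
  have htail := integrableOn_tailKernel_mul_K hf hX Λ
  have hR := (((tendsto_sineTransform hf hΛ).sub_const (sineTransform f X Λ)).const_mul
    ((2 * Real.cos (2 * π * ξ * Λ) : ℝ) : ℂ)).add
    (intervalIntegral_tendsto_integral_Ioi X htail tendsto_id)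
  refine tendsto_nhds_unique (hL.congr' ?_) hR
  filter_upwards [eventually_ge_atTop X] with T hT
  have hk (a b : ℝ) : IntegrableOn (fun t =>
      ((dirichletKernel Λ (t - ξ) + dirichletKernel Λ (t + ξ) : ℝ) : ℂ) * K f t) (Ioc a b) := by
    have h1 := integrableOn_kernel_mul (integrableOn_Ioc_K hf a b) Λ ξ
    have h2 := integrableOn_kernel_mul (integrableOn_Ioc_K hf a b) Λ (-ξ)
    refine (h1.add h2).congr_fun (fun t _ => ?_) measurableSet_Ioc
    simp only [Pi.add_apply, sub_neg_eq_add]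
    push_cast
    ring
  have hd (a b : ℝ) : IntegrableOn (fun t => (dirichletKernel Λ t : ℂ) * K f t) (Ioc a b) := by
    simpa using integrableOn_kernel_mul (integrableOn_Ioc_K hf a b) Λ 0
  have hunion : Ioc 0 T = Ioc 0 X ∪ Ioc X T := (Ioc_union_Ioc_eq_Ioc hX0.le hT).symm
  have hdis : Disjoint (Ioc 0 X) (Ioc X T) := Ioc_disjoint_Ioc_of_le le_rfl
  simp only [sineTransform, id]
  rw [hunion, setIntegral_union hdis measurableSet_Ioc (hk _ _) (hk _ _),
    setIntegral_union hdis measurableSet_Ioc (hd _ _) (hd _ _), add_sub_cancel_left,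
    add_sub_cancel_left, ← integral_const_mul, intervalIntegral.integral_of_le hT,
    ← integral_add ((hd _ _).const_mul _) (htail.mono_set Ioc_subset_Ioi_self)]
  refine setIntegral_congr_fun measurableSet_Ioc fun t ht => ?_
  rw [cosineKernel_eq_tail Λ (hX.trans ht.1)]
  push_cast
  ring

theorem integral_cosineKernel_symm (hf : Admissible f) (Λ ξ : ℝ) {X : ℝ} (hX : 0 ≤ X) :
    ∫ t in Ioc 0 X, ((dirichletKernel Λ (t - ξ) + dirichletKernel Λ (t + ξ) : ℝ) : ℂ) * K f t =
      (∫ t in Ioc (-X) 0, (dirichletKernel Λ (t - ξ) : ℂ) * K f t) +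
        ∫ t in Ioc 0 X, (dirichletKernel Λ (t - ξ) : ℂ) * K f t := by
  have h1 := integrableOn_kernel_mul (integrableOn_Ioc_K hf 0 X) Λ ξ
  have h2 := integrableOn_kernel_mul (integrableOn_Ioc_K hf 0 X) Λ (-ξ)
  have hneg : ∫ t in Ioc (-X) 0, (dirichletKernel Λ (t - ξ) : ℂ) * K f t =
      ∫ t in Ioc 0 X, (dirichletKernel Λ (t - -ξ) : ℂ) * K f t := by
    rw [← intervalIntegral.integral_of_le hX, ← intervalIntegral.integral_of_le (neg_nonpos.2 hX)]
    have h := intervalIntegral.integral_comp_neg (a := 0) (b := X)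
      fun t => (dirichletKernel Λ (t - ξ) : ℂ) * K f t
    rw [neg_zero] at h
    rw [← h]
    refine intervalIntegral.integral_congr fun t _ => ?_
    rw [K_neg hf.even, ← dirichletKernel_neg, neg_sub, sub_neg_eq_add, sub_neg_eq_add, add_comm]
  rw [hneg, ← integral_add h2 h1]
  refine setIntegral_congr_fun measurableSet_Ioc fun t _ => ?_
  simp only [sub_neg_eq_add]
  push_cast
  ring

/-- Localization of the truncated cosine transform to a window symmetric about the origin. -/
theorem tendsto_cosineTransform_sub (hf : Admissible f) {ξ X : ℝ} (hX : |ξ| < X) :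
    Tendsto (fun Λ : ℝ => (∫ x in Ioc 0 Λ, ((2 * Real.cos (2 * π * ξ * x) : ℝ) : ℂ) * F f x) -
      ((∫ t in Ioc (-X) 0, (dirichletKernel Λ (t - ξ) : ℂ) * K f t) +
        ∫ t in Ioc 0 X, (dirichletKernel Λ (t - ξ) : ℂ) * K f t)) atTop (𝓝 0) := by
  have hX0 : 0 < X := (abs_nonneg ξ).trans_lt hX
  -- Both terms tend to `K(0)/2`; the cosine factor oscillates but stays bounded.
  have hG : Tendsto (fun Λ => primitiveF f Λ - sineTransform f X Λ) atTop (𝓝 0) := by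
    have h := (tendsto_primitiveF hf).sub (tendsto_kernel_mul_K_zero hf hX0)
    rw [sub_self] at h
    refine h.congr fun Λ => ?_
    simp only [sineTransform, sub_zero]
  have hcos : Tendsto (fun Λ => ((2 * Real.cos (2 * π * ξ * Λ) : ℝ) : ℂ) *
      (primitiveF f Λ - sineTransform f X Λ)) atTop (𝓝 0) := by
    rw [tendsto_zero_iff_norm_tendsto_zero] at hG ⊢
    have h2 := hG.const_mul 2
    rw [mul_zero] at h2
    refine squeeze_zero (fun _ => norm_nonneg _) (fun Λ => ?_) h2
    rw [norm_mul, Complex.norm_real]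
    refine mul_le_mul_of_nonneg_right ?_ (norm_nonneg _)
    rw [norm_mul, Real.norm_two]
    exact mul_le_of_le_one_right zero_le_two (Real.abs_cos_le_one _)
  have h := hcos.add (tendsto_integral_tailKernel_mul_K hf hX)
  rw [add_zero] at h
  refine h.congr' ?_
  filter_upwards [eventually_ge_atTop 0] with Λ hΛ
  rw [← cosineTransform_sub_eq hf hX hΛ, integral_cosineKernel_symm hf Λ ξ hX0.le]

/-- Localization of the truncated cosine transform at its frequency. -/
theorem tendsto_cosineTransform_sub_window (hf : Admissible f) (ξ : ℝ) {δ : ℝ} (hδ : 0 < δ) :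
    Tendsto (fun Λ : ℝ => (∫ x in Ioc 0 Λ, ((2 * Real.cos (2 * π * ξ * x) : ℝ) : ℂ) * F f x) -
      ∫ t in Ioc (ξ - δ) (ξ + δ), (dirichletKernel Λ (t - ξ) : ℂ) * K f t) atTop (𝓝 0) := by
  let X := |ξ| + δ + 1
  have hX : |ξ| < X := by simp only [X]; linarith
  have h1 : -X ≤ ξ - δ := by simp only [X]; linarith [neg_abs_le ξ]
  have h2 : ξ + δ ≤ X := by simp only [X]; linarith [le_abs_self ξ]
  have hX0 : 0 ≤ X := (abs_nonneg ξ).trans hX.le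
  have hloc := locallyIntegrable_K hf
  have ha := tendsto_kernel_mul_away (hloc.integrableOn_isCompact (isCompact_Icc (a := -X)
    (b := ξ - δ))) (ξ := ξ) (fun h => by linarith [h.2])
  have hb := tendsto_kernel_mul_away (hloc.integrableOn_isCompact (isCompact_Icc (a := ξ + δ)
    (b := X))) (ξ := ξ) (fun h => by linarith [h.1])
  have h := ((tendsto_cosineTransform_sub hf hX).add ha).add hb
  rw [add_zero, add_zero] at h
  refine h.congr fun Λ => ?_
  have hi (a b : ℝ) := integrableOn_kernel_mul (integrableOn_Ioc_K hf a b) Λ ξ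
  rw [← setIntegral_union (Ioc_disjoint_Ioc_of_le le_rfl) measurableSet_Ioc (hi _ _) (hi _ _),
    Ioc_union_Ioc_eq_Ioc (neg_nonpos.2 hX0) hX0,
    ← Ioc_union_Ioc_eq_Ioc (h1.trans (by linarith : ξ - δ ≤ ξ + δ)) h2,
    ← Ioc_union_Ioc_eq_Ioc h1 (by linarith : ξ - δ ≤ ξ + δ),
    setIntegral_union (Disjoint.union_left (Ioc_disjoint_Ioc_of_le (by linarith))
      (Ioc_disjoint_Ioc_of_le le_rfl)) measurableSet_Ioc
      ((hi _ _).union (hi _ _)) (hi _ _),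
    setIntegral_union (Ioc_disjoint_Ioc_of_le le_rfl) measurableSet_Ioc (hi _ _) (hi _ _)]
  ring

/-- For `ξ > 0` the left integral vanishes in the limit and the kernel has mass `1` on `(0, X]`. For
`ξ = 0` evenness gives `-moment f / 2` on the left, and the mass is `1/2`. The total is the same, so
the co-sum formula needs no case distinction at the origin. -/
theorem tendsto_kernel_left_sub (hf : Admissible f) {ξ X : ℝ} (hξ : 0 ≤ ξ) (hX : ξ < X) :
    Tendsto (fun Λ : ℝ => (∫ t in Ioc (-X) 0, (dirichletKernel Λ (t - ξ) : ℂ) * K f t) -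
      ((∫ t in (0 : ℝ)..X, dirichletKernel Λ (t - ξ) : ℝ) : ℂ) * moment f) atTop
      (𝓝 (-moment f)) := by
  rcases hξ.eq_or_lt with rfl | hξ
  · have h1 := tendsto_kernel_mul_K_zero hf hX
    have h2 := ((Complex.continuous_ofReal.tendsto _).comp
      (tendsto_integral_kernel_zero hX)).mul_const (moment f)
    have h := h1.sub h2
    rw [show K f 0 / 2 - ((1 / 2 : ℝ) : ℂ) * moment f = -moment f by
      rw [K_zero]; push_cast; ring] at h
    refine h.congr fun Λ => ?_
    have e := integral_cosineKernel_symm hf Λ 0 hX.le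
    have hi := integrableOn_kernel_mul (integrableOn_Ioc_K hf 0 X) Λ 0
    have e2 : ∫ t in Ioc 0 X,
        ((dirichletKernel Λ (t - 0) + dirichletKernel Λ (t + 0) : ℝ) : ℂ) * K f t =
        (∫ t in Ioc 0 X, (dirichletKernel Λ (t - 0) : ℂ) * K f t) +
          ∫ t in Ioc 0 X, (dirichletKernel Λ (t - 0) : ℂ) * K f t := by
      rw [← integral_add hi hi]
      refine setIntegral_congr_fun measurableSet_Ioc fun t _ => ?_
      simp only [sub_zero, add_zero]
      push_cast
      ring
    rw [e2] at e
    rw [← add_right_cancel e]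
    rfl
  · have h1 := tendsto_kernel_mul_away ((locallyIntegrable_K hf).integrableOn_isCompact
      (isCompact_Icc (a := -X) (b := 0))) (ξ := ξ) (fun h => by linarith [h.2])
    have h2 := ((Complex.continuous_ofReal.tendsto _).comp
      (tendsto_integral_kernel hξ hX)).mul_const (moment f)
    have h := h1.sub h2
    simpa using h

end Localization

/-! ### Assembly -/

theorem ae_of_Ioi {p : ℝ → Prop} (h : ∀ᵐ t ∂volume.restrict (Ioi (0 : ℝ)), p t)
    (hneg : ∀ t, p (-t) → p t) : ∀ᵐ t, p t := by
  rw [ae_restrict_iff' measurableSet_Ioi] at h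
  have h2 := (Measure.measurePreserving_neg (volume : Measure ℝ)).quasiMeasurePreserving.ae h
  have h3 : ∀ᵐ t : ℝ, t ≠ 0 := by simp [ae_iff]
  filter_upwards [h, h2, h3] with t ht ht2 ht3
  rcases lt_or_gt_of_ne ht3 with h0 | h0
  · exact hneg t (ht2 (neg_pos.2 h0))
  · exact ht h0

theorem Admissible.of_weighted {f : ℝ → ℂ} (hmeas : AEMeasurable f volume)
    (heven : ∀ x, f (-x) = f x)
    (hC : IntegrableOn (fun x : ℝ => ‖f x‖ * (1 + 1 / x)) (Ioi 0) volume) : Admissible f where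
  even := heven
  int := by
    refine Integrable.mono' hC hmeas.restrict.aestronglyMeasurable ?_
    filter_upwards [ae_restrict_mem measurableSet_Ioi] with x hx
    have : 0 < 1 / x := one_div_pos.2 hx
    nlinarith [norm_nonneg (f x)]
  int_div := by
    refine Integrable.mono' hC
      (hmeas.restrict.div Complex.measurable_ofReal.aemeasurable).aestronglyMeasurable ?_
    filter_upwards [ae_restrict_mem measurableSet_Ioi] with x hx
    have hx : 0 < x := hx
    rw [norm_div, Complex.norm_real, Real.norm_of_nonneg hx.le, div_eq_mul_one_div]
    nlinarith [norm_nonneg (f x)]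

theorem integrableOn_cosine_mul_F {f : ℝ → ℂ} (hf : Admissible f) (ξ b : ℝ) :
    IntegrableOn (fun x => ((2 * Real.cos (2 * π * ξ * x) : ℝ) : ℂ) * F f x) (Ioc 0 b) := by
  refine (integrableOn_Ioc_F hf 0 b).bdd_mul (c := 2)
    (Continuous.aestronglyMeasurable (by fun_prop)) (Eventually.of_forall fun t => ?_)
  rw [Complex.norm_real, norm_mul, Real.norm_two]
  exact mul_le_of_le_one_right zero_le_two (Real.abs_cos_le_one _)

theorem eventually_intervalIntegral_eq (g : ℝ → ℂ) :
    ∀ᶠ b : ℝ in atTop, ∫ x in Ioc 0 b, g x = ∫ x in (0 : ℝ)..b, g x := by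
  filter_upwards [eventually_ge_atTop 0] with b hb
  rw [intervalIntegral.integral_of_le hb]

end CoPoisson

open CoPoisson

theorem mainTheorem1 (f : ℝ → ℂ) (hmeas : AEMeasurable f volume) (heven : ∀ x, f (-x) = f x)
    (hC : IntegrableOn (fun x : ℝ => ‖f x‖ * (1 + 1 / x)) (Ioi 0) volume) :
    -- the two series converge absolutely almost everywhere
    ((∀ᵐ x : ℝ, Summable fun n : ℕ => ‖f (((n : ℝ) + 1) / x) / ((|x| : ℝ) : ℂ)‖) ∧
      (∀ᵐ x : ℝ, Summable fun n : ℕ => ‖f (x / ((n : ℝ) + 1)) / ((n : ℂ) + 1)‖)) ∧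
    -- (1)
    (∃ TF TK : 𝓢'(ℝ, ℂ), CoPoisson.IsGivenBy TF (CoPoisson.F f) ∧
      CoPoisson.IsGivenBy TK (CoPoisson.K f) ∧
      𝓕 TF = TK ∧ 𝓕 TK = TF ∧ 𝓕⁻ TF = TK ∧ 𝓕⁻ TK = TF) ∧
    -- (2)
    CoPoisson.HasImproperIntegral (CoPoisson.F f) (CoPoisson.K f 0 / 2) ∧
    -- (3)
    (∀ Λ ξ : ℝ, 0 ≤ Λ → 0 ≤ ξ →
      CoPoisson.HasImproperIntegral
        (fun t => ((CoPoisson.dirichletKernel Λ (t - ξ) +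
          CoPoisson.dirichletKernel Λ (t + ξ) : ℝ) : ℂ) * CoPoisson.K f t)
        (∫ x in (0 : ℝ)..Λ, ((2 * Real.cos (2 * π * ξ * x) : ℝ) : ℂ) * CoPoisson.F f x)) ∧
    -- (4)
    (∀ ξ X : ℝ, 0 ≤ ξ → ξ < X →
      IntegrableOn (CoPoisson.coSum f) (Ioc 0 X) volume ∧
      IntegrableOn (fun u : ℝ => f u / (u : ℂ)) (Ioi 0) volume ∧
      Tendsto (fun Λ : ℝ =>
        (∫ x in (0 : ℝ)..Λ, ((2 * Real.cos (2 * π * ξ * x) : ℝ) : ℂ) * CoPoisson.F f x) -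
          ((∫ t in (0 : ℝ)..X,
              (CoPoisson.dirichletKernel Λ (t - ξ) : ℂ) * CoPoisson.coSum f t) -
            ∫ u in Ioi (0 : ℝ), f u / (u : ℂ)))
        atTop (𝓝 0)) ∧
    -- pointwise validity in terms of Dirichlet points
    (∀ (ξ : ℝ) (L : ℂ),
      CoPoisson.HasImproperIntegral
          (fun x => ((2 * Real.cos (2 * π * ξ * x) : ℝ) : ℂ) * CoPoisson.F f x) L ↔
        CoPoisson.HasDirichletValue (CoPoisson.K f) ξ L) := by
  have hf : Admissible f := Admissible.of_weighted hmeas heven hC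
  have hTK := exists_isGivenBy_K hf
  have hTF := exists_isGivenBy_K hf.inversion
  rw [← F_eq_K_inversion] at hTF
  refine ⟨⟨?_, ?_⟩, ?_, ?_, ?_, ?_, ?_⟩
  · refine ae_of_Ioi ?_ fun t ht => ?_
    · filter_upwards [ae_summable_coSum hf.inversion, ae_restrict_mem measurableSet_Ioi] with t ht ht0
      refine ht.congr fun n => ?_
      rw [inversion_term f (ne_of_gt ht0)]
    · simpa only [div_neg, heven, abs_neg] using ht
  · refine ae_of_Ioi (ae_summable_coSum hf) fun t ht => ?_
    simpa only [neg_div, heven] using ht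
  · obtain ⟨TF, hTF⟩ := hTF
    obtain ⟨TK, hTK⟩ := hTK
    have h1 : 𝓕 TF = TK := by
      ext g
      rw [TemperedDistribution.fourier_apply, (hTF.2 _).2, (hTK.2 _).2, integral_fourier_mul_F hf]
    have h2 : 𝓕 TK = TF := by
      ext g
      have h := integral_fourier_mul_F hf.inversion g
      rw [F_inversion, ← F_eq_K_inversion] at h
      rw [TemperedDistribution.fourier_apply, (hTF.2 _).2, (hTK.2 _).2, h]
    refine ⟨TF, TK, hTF, hTK, h1, h2, ?_, ?_⟩
    · rw [← h2, FourierTransform.fourierInv_fourier_eq]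
    · rw [← h1, FourierTransform.fourierInv_fourier_eq]
  · exact ⟨integrableOn_Ioc_F hf 0,
      (tendsto_primitiveF hf).congr' (eventually_intervalIntegral_eq (F f))⟩
  · intro Λ ξ hΛ _
    refine ⟨fun b => ?_, ?_⟩
    · have h1 := integrableOn_kernel_mul (integrableOn_Ioc_K hf 0 b) Λ ξ
      have h2 := integrableOn_kernel_mul (integrableOn_Ioc_K hf 0 b) Λ (-ξ)
      refine (h1.add h2).congr_fun (fun t _ => ?_) measurableSet_Ioc
      simp only [Pi.add_apply, sub_neg_eq_add]
      push_cast
      ring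
    · rw [intervalIntegral.integral_of_le hΛ]
      exact (tendsto_integral_cosineKernel_mul_K hf ξ hΛ).congr' (eventually_intervalIntegral_eq _)
  · intro ξ X hξ hX
    refine ⟨integrableOn_Ioc_coSum hf X, hf.int_div, ?_⟩
    have hX0 : 0 ≤ X := hξ.trans hX.le
    -- Replacing `K` by the co-sum on `(0, X]` costs the kernel mass times the moment, which
    -- `tendsto_kernel_left_sub` balances against the integral over `(-X, 0]`.
    have h := ((tendsto_cosineTransform_sub hf (ξ := ξ) (X := X) (by rwa [abs_of_nonneg hξ])).add
      (tendsto_kernel_left_sub hf hξ hX)).add_const (moment f)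
    rw [zero_add, neg_add_cancel] at h
    refine h.congr' ?_
    filter_upwards [eventually_intervalIntegral_eq
      (fun x => ((2 * Real.cos (2 * π * ξ * x) : ℝ) : ℂ) * F f x)] with Λ hΛ
    rw [← hΛ, integral_kernel_mul_K hf hX0, intervalIntegral.integral_of_le hX0
      (f := fun t => (dirichletKernel Λ (t - ξ) : ℂ) * coSum f t), moment]
    ring
  · intro ξ L
    have hloc := locallyIntegrable_K hf
    -- The truncated cosine transform and the Dirichlet integral over any window differ by `o(1)`,
    -- so one converges exactly when the other does, to the same value.
    have hw (δ : ℝ) (hδ : 0 < δ) : Tendsto (fun Λ : ℝ =>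
        (∫ x in (0 : ℝ)..Λ, ((2 * Real.cos (2 * π * ξ * x) : ℝ) : ℂ) * F f x) -
          ∫ x in (ξ - δ)..(ξ + δ), (dirichletKernel Λ (x - ξ) : ℂ) * K f x) atTop (𝓝 0) := by
      refine (tendsto_cosineTransform_sub_window hf ξ hδ).congr' ?_
      filter_upwards [eventually_intervalIntegral_eq
        (fun x => ((2 * Real.cos (2 * π * ξ * x) : ℝ) : ℂ) * F f x)] with Λ hΛ
      rw [← hΛ, intervalIntegral.integral_of_le (by linarith : ξ - δ ≤ ξ + δ)]
    constructor
    · rintro ⟨-, h⟩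
      refine ⟨hloc, fun δ hδ => ?_⟩
      simpa using h.sub (hw δ hδ)
    · rintro ⟨-, h⟩
      refine ⟨integrableOn_cosine_mul_F hf ξ, ?_⟩
      simpa using (hw 1 one_pos).add (h 1 one_pos)
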